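/- Let $X$ be a topological space. A sheaf of AQ central series $\mathcal H=(\mathcal H_j)_{j\ge 0}$ on $X$ consists of a sheaf of groups $\mathcal G=\mathcal H_0$ and a decreasing sequence of subsheaves of normal subgroups $\mathcal H_{j}\subset\mathcal G$, such that each quotient sheaf $\mathcal A_j=\mathcal H_j/\mathcal H_{j+1}$ is a sheaf of abelian groups, and such that for each $j>0$ there is some $k<j$ for which the extension of sheaves of groups $$\{e\}\to\mathcal A_j\to\mathcal H_k/\mathcal H_{j+1}\to\mathcal H_k/\mathcal H_j\to\{e\}\qquad(E_{k,j})$$ is central; call such a $k$ admissible for $j$. For $k$ admissible for $j$, let $\delta^1_{k,j}:H^0(X,\mathcal H_k/\mathcal H_j)\to H^1(X,\mathcal A_j)$ and $\delta^2_{k,j}:\check H^1(X,\mathcal H_k/\mathcal H_j)\to H^2(X,\mathcal A_j)$ be the connecting maps of Grothendieck's nonabelian long exact sequence of $(E_{k,j})$: $\delta^1_{k,j}$ sends a global section with local lifts $g_r$ to $\mathcal H_k/\mathcal H_{j+1}$ to the class of the cocycle $g_rg_s^{-1}$, and $\delta^2_{k,j}$ sends the class of a cocycle $(c_{rs})$,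 with local lifts $b_{rs}$ to $\mathcal H_k/\mathcal H_{j+1}$ (defined on open coverings of the intersections), to the class of the $2$-cocycle $b_{rs}b_{st}b_{rt}^{-1}$. Here $\check H^1$ is the (pointed) Čech cohomology set of a sheaf of groups and $H^n$ is sheaf cohomology of sheaves of abelian groups. Then for each $j\ge 0$ there are maps of pointed sets $$H^0(X,\mathcal A_j)\xrightarrow{\ \partial^1_{j+1}\ }H^1(X,\mathcal A_{j+1})\xrightarrow{\ \partial^2_{j+2}\ }H^2(X,\mathcal A_{j+2})$$ such that the following hold. * $\partial^1_{j+1}$ is the composite $H^0(X,\mathcal A_j)\to H^0(X,\mathcal H_k/\mathcal H_{j+1})\xrightarrow{\delta^1_{k,j+1}}H^1(X,\mathcal A_{j+1})$ for every $k$ admissible for $j+1$, where the first map is induced by the inclusion $\mathcal A_j\subset\mathcal H_k/\mathcal H_{j+1}$. * $\partial^2_{j+2}$ is the composite $H^1(X,\mathcal A_{j+1})\to\check H^1(X,\mathcal H_k/\mathcal H_{j+2})\xrightarrow{\delta^2_{k,j+2}}H^2(X,\mathcal A_{j+2})$ for every $k$ admissible for $j+2$, where the first map is induced by the inclusion $\mathcal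 A_{j+1}\subset\mathcal H_k/\mathcal H_{j+2}$. * The composite is trivial: $\partial^2_{j+2}\circ\partial^1_{j+1}=0$. -/

import Mathlib

open CategoryTheory TopologicalSpace Opposite

universe u

/-- Filtered colimits of groups exist; this makes sheafification of presheaves of groups
available. -/
instance GrpCat.hasColimitsOfShape_of_isFiltered (J : Type u) [SmallCategory J] [IsFiltered J] :
    Limits.HasColimitsOfShape J GrpCat.{u} where
  has_colimit F := ⟨⟨_, GrpCat.FilteredColimits.colimitCoconeIsColimit F⟩⟩

namespace AQSeries

variable {X : TopCat.{u}}

/-! ### Sheaves of groups and of abelian groups on a topological space -/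

/-- Sheaves of (not necessarily commutative) groups on `X`. -/
abbrev GrpSheaf (X : TopCat.{u}) := Sheaf (Opens.grothendieckTopology X) GrpCat.{u}

/-- Sheaves of abelian groups on `X`. -/
abbrev AbSheaf (X : TopCat.{u}) := Sheaf (Opens.grothendieckTopology X) AddCommGrpCat.{u}

/-- The group of sections of a sheaf of groups over an open set. -/
abbrev GrpSheaf.sec (G : GrpSheaf X) (U : Opens X) : Type u := G.obj.obj (op U)

/-- Restriction of sections. -/
abbrev GrpSheaf.res (G : GrpSheaf X) {U V : Opens X} (h : V ≤ U) : G.sec U →* G.sec V :=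
  (G.obj.map (homOfLE h).op).hom

/-- The action of a morphism of sheaves of groups on sections. -/
abbrev GrpSheaf.app {G G' : GrpSheaf X} (f : G ⟶ G') (U : Opens X) : G.sec U →* G'.sec U :=
  (f.hom.app (op U)).hom

/-- The abelian group of sections of a sheaf of abelian groups over an open set. -/
abbrev AbSheaf.sec (F : AbSheaf X) (U : Opens X) : Type u := F.obj.obj (op U)

/-- Restriction of sections. -/
abbrev AbSheaf.res (F : AbSheaf X) {U V : Opens X} (h : V ≤ U) : F.sec U →+ F.sec V :=
  (F.obj.map (homOfLE h).op).hom

/-- The action of a morphism of sheaves of abelian groups on sections. -/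
abbrev AbSheaf.app {F F' : AbSheaf X} (f : F ⟶ F') (U : Opens X) : F.sec U →+ F'.sec U :=
  (f.hom.app (op U)).hom

/-- A sheaf of groups is commutative if all its groups of sections are. -/
def GrpSheaf.IsComm (A : GrpSheaf X) : Prop :=
  ∀ (U : Opens X) (a b : A.sec U), a * b = b * a

/-- The commutative group structure on the sections of a commutative sheaf of groups. -/
abbrev GrpSheaf.commGroup (A : GrpSheaf X) (h : A.IsComm) (U : (Opens X)ᵒᵖ) :
    CommGroup (A.obj.obj U) :=
  { (inferInstance : Group (A.obj.obj U)) with mul_comm := h U.unop }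

/-- The presheaf of abelian groups `U ↦ Additive (A(U))` attached to a commutative sheaf of
groups `A`. -/
def GrpSheaf.toAbPresheaf (A : GrpSheaf X) (h : A.IsComm) : (Opens X)ᵒᵖ ⥤ AddCommGrpCat.{u} where
  obj U :=
    letI := A.commGroup h U
    AddCommGrpCat.of (Additive (A.obj.obj U))
  map {U V} f :=
    letI := A.commGroup h U
    letI := A.commGroup h V
    AddCommGrpCat.ofHom (MonoidHom.toAdditive (A.obj.map f).hom)
  map_id U := by
    refine AddCommGrpCat.hom_ext (AddMonoidHom.ext fun x => ?_)
    have e : (A.obj.map (𝟙 U)).hom (Additive.toMul x) = Additive.toMul x := by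
      rw [A.obj.map_id]; rfl
    exact congrArg Additive.ofMul e
  map_comp {U V W} f g := by
    refine AddCommGrpCat.hom_ext (AddMonoidHom.ext fun x => ?_)
    have e : (A.obj.map (f ≫ g)).hom (Additive.toMul x) =
        (A.obj.map g).hom ((A.obj.map f).hom (Additive.toMul x)) := by
      rw [A.obj.map_comp]; rfl
    exact congrArg Additive.ofMul e

/-- A commutative sheaf of groups, written additively, as a sheaf of abelian groups. -/
def GrpSheaf.toAb (A : GrpSheaf X) (h : A.IsComm) : AbSheaf X where
  obj := A.toAbPresheaf h
  property := by
    rw [Presheaf.isSheaf_iff_isSheaf_forget _ _ (CategoryTheory.forget AddCommGrpCat.{u})]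
    have hA := (Presheaf.isSheaf_iff_isSheaf_forget _ _ (CategoryTheory.forget GrpCat.{u})).1
      A.property
    exact hA

/-- Sections of the additive version of a commutative sheaf of groups. -/
def GrpSheaf.toAbSec (A : GrpSheaf X) (h : A.IsComm) (U : Opens X) :
    Additive (A.sec U) ≃+ (A.toAb h).sec U :=
  AddEquiv.refl _

/-! ### Series of normal subsheaves -/

/-- A subsheaf of normal subgroups of a sheaf of groups `G`: normal subgroups `H(U) ⊆ G(U)`,
stable under restriction, such that a section of `G` which lies in `H` locally lies in `H`. -/
structure NormalSubsheaf (G : GrpSheaf X) where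
  carrier : ∀ U : Opens X, Subgroup (G.sec U)
  normal : ∀ U, (carrier U).Normal
  res_mem : ∀ {U V : Opens X} (h : V ≤ U) (s : G.sec U), s ∈ carrier U → G.res h s ∈ carrier V
  local_mem : ∀ (U : Opens X) (s : G.sec U),
    (∀ x ∈ U, ∃ (V : Opens X) (h : V ≤ U), x ∈ V ∧ G.res h s ∈ carrier V) → s ∈ carrier U

/-- A sheaf of normal series `𝓗 = (𝓗_j)_{j ≥ 0}` on `X`: a decreasing sequence of subsheaves of
normal subgroups of a sheaf of groups `𝓖 = 𝓗_0`. -/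
structure NormalSeries (X : TopCat.{u}) where
  G : GrpSheaf X
  H : ℕ → NormalSubsheaf G
  H_zero : ∀ U, (H 0).carrier U = ⊤
  H_succ_le : ∀ j U, (H (j + 1)).carrier U ≤ (H j).carrier U

namespace NormalSeries

variable (𝓗 : NormalSeries X)

lemma le {i j : ℕ} (h : i ≤ j) (U : Opens X) : (𝓗.H j).carrier U ≤ (𝓗.H i).carrier U := by
  induction j, h using Nat.le_induction with
  | base => exact le_rfl
  | succ j _ ih => exact (𝓗.H_succ_le j U).trans ih

/-- The group of sections `𝓗_k(U)`. -/
abbrev grp (k : ℕ) (U : Opens X) : Type u := (𝓗.H k).carrier U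

/-- The normal subgroup `𝓗_j(U)` of `𝓗_k(U)`, for `k ≤ j`. -/
abbrev sub (k j : ℕ) (U : Opens X) : Subgroup (𝓗.grp k U) :=
  ((𝓗.H j).carrier U).subgroupOf ((𝓗.H k).carrier U)

instance (k j : ℕ) (U : Opens X) : (𝓗.sub k j U).Normal :=
  haveI := (𝓗.H j).normal U
  inferInstance

/-- Restriction of sections of `𝓗_k`. -/
def grpRes (k : ℕ) {U V : Opens X} (h : V ≤ U) : 𝓗.grp k U →* 𝓗.grp k V :=
  ((𝓗.G.res h).comp ((𝓗.H k).carrier U).subtype).codRestrict ((𝓗.H k).carrier V)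
    (fun s => (𝓗.H k).res_mem h s.1 s.2)

/-- The presheaf `U ↦ 𝓗_k(U) / 𝓗_j(U)`, for `k ≤ j`. -/
def quotPresheaf (k j : ℕ) : (Opens X)ᵒᵖ ⥤ GrpCat.{u} where
  obj U := GrpCat.of (𝓗.grp k U.unop ⧸ 𝓗.sub k j U.unop)
  map {U V} f := GrpCat.ofHom (QuotientGroup.map (𝓗.sub k j U.unop) (𝓗.sub k j V.unop)
    (𝓗.grpRes k (leOfHom f.unop)) (fun s hs => (𝓗.H j).res_mem (leOfHom f.unop) s.1 hs))
  map_id U := by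
    refine GrpCat.hom_ext (MonoidHom.ext fun x => ?_)
    induction x using QuotientGroup.induction_on with
    | H s =>
      refine congrArg QuotientGroup.mk (Subtype.ext ?_)
      change (𝓗.G.obj.map (𝟙 U)).hom s.1 = s.1
      rw [𝓗.G.obj.map_id]; rfl
  map_comp {U V W} f g := by
    refine GrpCat.hom_ext (MonoidHom.ext fun x => ?_)
    induction x using QuotientGroup.induction_on with
    | H s =>
      refine congrArg QuotientGroup.mk (Subtype.ext ?_)
      change (𝓗.G.obj.map (f ≫ g)).hom s.1 = (𝓗.G.obj.map g).hom ((𝓗.G.obj.map f).hom s.1)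
      rw [𝓗.G.obj.map_comp]; rfl

/-- The homomorphism of presheaves `𝓗_k / 𝓗_j ⟶ 𝓗_l / 𝓗_m` induced by the inclusions
`𝓗_k ⊆ 𝓗_l` and `𝓗_j ⊆ 𝓗_m`, for `l ≤ k` and `m ≤ j`. -/
def quotPresheafMap {k j l m : ℕ} (hk : l ≤ k) (hj : m ≤ j) :
    𝓗.quotPresheaf k j ⟶ 𝓗.quotPresheaf l m where
  app U := GrpCat.ofHom (QuotientGroup.map (𝓗.sub k j U.unop) (𝓗.sub l m U.unop)
    (Subgroup.inclusion (𝓗.le hk U.unop)) (fun _ hs => 𝓗.le hj U.unop hs))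
  naturality U V f := by
    refine GrpCat.hom_ext (MonoidHom.ext fun x => ?_)
    induction x using QuotientGroup.induction_on with
    | H s => rfl

/-- The quotient sheaf of groups `𝓗_k / 𝓗_j`, for `k ≤ j`. -/
noncomputable def quot (k j : ℕ) : GrpSheaf X :=
  (presheafToSheaf (Opens.grothendieckTopology X) GrpCat.{u}).obj (𝓗.quotPresheaf k j)

/-- The homomorphism of sheaves `𝓗_k / 𝓗_j ⟶ 𝓗_l / 𝓗_m`, for `l ≤ k` and `m ≤ j`. -/
noncomputable def quotMap {k j l m : ℕ} (hk : l ≤ k) (hj : m ≤ j) : 𝓗.quot k j ⟶ 𝓗.quot l m :=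
  (presheafToSheaf (Opens.grothendieckTopology X) GrpCat.{u}).map (𝓗.quotPresheafMap hk hj)

/-- For `k < j`, the inclusion `𝓗_j / 𝓗_{j+1} ⟶ 𝓗_k / 𝓗_{j+1}`. -/
noncomputable abbrev incl {k j : ℕ} (h : k < j) : 𝓗.quot j (j + 1) ⟶ 𝓗.quot k (j + 1) :=
  𝓗.quotMap h.le le_rfl

/-- For `k < j`, the projection `𝓗_k / 𝓗_{j+1} ⟶ 𝓗_k / 𝓗_j`. -/
noncomputable abbrev proj (k j : ℕ) : 𝓗.quot k (j + 1) ⟶ 𝓗.quot k j :=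
  𝓗.quotMap le_rfl j.le_succ

/-- For `k < j`, the extension
`1 ⟶ 𝓗_j / 𝓗_{j+1} ⟶ 𝓗_k / 𝓗_{j+1} ⟶ 𝓗_k / 𝓗_j ⟶ 1` is central. -/
def IsCentralAt {k j : ℕ} (h : k < j) : Prop :=
  ∀ (U : Opens X) (a : (𝓗.quot j (j + 1)).sec U) (b : (𝓗.quot k (j + 1)).sec U),
    GrpSheaf.app (𝓗.incl h) U a * b = b * GrpSheaf.app (𝓗.incl h) U a

end NormalSeries

/-- A sheaf of AQ ("abelian-quotient") central series on `X`: a sheaf of normal series whose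
successive quotients `𝓗_j / 𝓗_{j+1}` are sheaves of abelian groups and such that for each `j > 0`
there is some `k < j` for which `𝓗_j / 𝓗_{j+1}` is central in `𝓗_k / 𝓗_{j+1}`. -/
structure AQCentralSeries (X : TopCat.{u}) extends NormalSeries X where
  comm : ∀ j, (toNormalSeries.quot j (j + 1)).IsComm
  central : ∀ j, 0 < j → ∃ (k : ℕ) (h : k < j), toNormalSeries.IsCentralAt h

/-- The sheaf of abelian groups `𝓐_j = 𝓗_j / 𝓗_{j+1}`. -/
noncomputable def AQCentralSeries.A (𝓗 : AQCentralSeries X) (j : ℕ) : AbSheaf X :=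
  (𝓗.quot j (j + 1)).toAb (𝓗.comm j)

/-! ### Nonabelian cohomology in degree one -/

/-- An open covering of `X`. -/
structure OpenCover (X : TopCat.{u}) where
  ι : Type u
  U : ι → Opens X
  isOpenCover : IsOpenCover U

/-- `𝓥` refines `𝓤` through the map of index sets `ρ`. -/
def OpenCover.Refines (𝓥 𝓤 : OpenCover X) (ρ : 𝓥.ι → 𝓤.ι) : Prop :=
  ∀ v, 𝓥.U v ≤ 𝓤.U (ρ v)

/-- Cocycles `g_{ij} ∈ G(U_i ∩ U_j)`, with `g_{ij} g_{jk} = g_{ik}`, on an open covering. -/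
abbrev Cocycle (G : GrpSheaf X) (𝓤 : OpenCover X) :=
  PresheafOfGroups.OneCocycle G.obj 𝓤.U

/-- The component `g_{ij}` of a cocycle. -/
abbrev Cocycle.val {G : GrpSheaf X} {𝓤 : OpenCover X} (γ : Cocycle G 𝓤) (i j : 𝓤.ι) :
    G.sec (𝓤.U i ⊓ 𝓤.U j) :=
  γ.ev i j (homOfLE inf_le_left) (homOfLE inf_le_right)

/-- Restriction of a cocycle to a refinement. -/
def Cocycle.refine {G : GrpSheaf X} {𝓤 𝓥 : OpenCover X} (γ : Cocycle G 𝓤) {ρ : 𝓥.ι → 𝓤.ι}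
    (h : 𝓥.Refines 𝓤 ρ) : Cocycle G 𝓥 where
  ev v w _ a b := γ.ev (ρ v) (ρ w) (a ≫ homOfLE (h v)) (b ≫ homOfLE (h w))
  ev_precomp v w _ _ φ a b := by simp
  ev_trans v w z _ a b c := γ.ev_trans _ _ _ _ _ _

/-- The image of a cocycle under a morphism of sheaves of groups. -/
def Cocycle.map {G G' : GrpSheaf X} {𝓤 : OpenCover X} (f : G ⟶ G') (γ : Cocycle G 𝓤) :
    Cocycle G' 𝓤 where
  ev i j T a b := GrpSheaf.app f T (γ.ev i j a b)
  ev_precomp i j T T' φ a b := by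
    have e : ∀ x : G.sec T', (G'.obj.map φ.op).hom (GrpSheaf.app f T' x) =
        GrpSheaf.app f T ((G.obj.map φ.op).hom x) := fun x =>
      (ConcreteCategory.congr_hom (f.hom.naturality φ.op) x).symm
    exact (e _).trans (congrArg _ (γ.ev_precomp i j φ a b))
  ev_trans i j k T a b c := by
    rw [← map_mul, γ.ev_trans]

/-- Two cocycles, on possibly different coverings, are equivalent if they become cohomologous on a
common refinement. -/
def Cocycle.Equivalent {G : GrpSheaf X} (c c' : Σ 𝓤 : OpenCover X, Cocycle G 𝓤) : Prop :=
  ∃ (𝓦 : OpenCover X) (ρ : 𝓦.ι → c.1.ι) (σ : 𝓦.ι → c'.1.ι)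
    (hρ : 𝓦.Refines c.1 ρ) (hσ : 𝓦.Refines c'.1 σ),
    (Cocycle.refine c.2 hρ).IsCohomologous (Cocycle.refine c'.2 hσ)

/-- The Čech cohomology set `Ȟ¹(X, G)` of a sheaf of groups: the colimit over all open coverings
of the sets of cohomology classes of cocycles. -/
def CechH1 (G : GrpSheaf X) : Type (u + 1) := Quot (Cocycle.Equivalent (G := G))

/-- The class of a cocycle in `Ȟ¹(X, G)`. -/
def Cocycle.cls {G : GrpSheaf X} {𝓤 : OpenCover X} (γ : Cocycle G 𝓤) : CechH1 G :=
  Quot.mk _ ⟨𝓤, γ⟩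

/-! ### Cohomology classes of abelian cocycles

Cohomology of a sheaf of abelian groups is Mathlib's `Sheaf.H`. -/

/-- The class in `H⁰(X, F)` of a global section. -/
noncomputable def classH0 (F : AbSheaf X) : F.sec ⊤ ≃+ Sheaf.H F 0 :=
  (Sheaf.H.equiv₀ F Limits.isTerminalTop).symm

/-- The connecting homomorphism `Hⁿ(X, Q) → Hⁿ⁺¹(X, F)` of a short exact sequence
`0 ⟶ F ⟶ I ⟶ Q ⟶ 0` of sheaves of abelian groups. -/
noncomputable def connecting {S : ShortComplex (AbSheaf X)} (hS : S.ShortExact) (n : ℕ) :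
    Sheaf.H S.X₃ n → Sheaf.H S.X₁ (n + 1) :=
  fun x => x.comp hS.extClass rfl

/-- `η ∈ H¹(X, F)` is the cohomology class of the Čech cochain `a_{ij} ∈ F(U_i ∩ U_j)` (which is
then a cocycle): there are a short exact sequence `0 ⟶ F ⟶ I ⟶ Q ⟶ 0`, a global section `q` of `Q`
and lifts `t_i ∈ I(U_i)` of `q` with `a_{ij} = t_i - t_j`, such that `η` is the image of `q` under
the connecting homomorphism. -/
def RepresentsH1 (F : AbSheaf X) {𝓤 : OpenCover X} (a : ∀ i j, F.sec (𝓤.U i ⊓ 𝓤.U j))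
    (η : Sheaf.H F 1) : Prop :=
  ∃ (I Q : AbSheaf X) (f : F ⟶ I) (g : I ⟶ Q) (w : f ≫ g = 0)
    (hS : (ShortComplex.mk f g w).ShortExact) (q : Q.sec ⊤) (t : ∀ i, I.sec (𝓤.U i)),
    (∀ i, AbSheaf.app g (𝓤.U i) (t i) = Q.res le_top q) ∧
    (∀ i j, AbSheaf.app f (𝓤.U i ⊓ 𝓤.U j) (a i j) =
      I.res inf_le_left (t i) - I.res inf_le_right (t j)) ∧
    η = connecting hS 0 (classH0 Q q)

/-- An open covering `(U_i)` together with an open covering `(V_e)` of each intersection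
`U_i ∩ U_j`. -/
structure HyperCover (X : TopCat.{u}) extends OpenCover X where
  E : ι → ι → Type u
  V : ∀ {i j : ι}, E i j → Opens X
  iSup_V : ∀ i j, ⨆ e : E i j, V e = U i ⊓ U j

namespace HyperCover

variable (𝓤 : HyperCover X)

lemma V_le {i j : 𝓤.ι} (e : 𝓤.E i j) : 𝓤.V e ≤ 𝓤.U i ⊓ 𝓤.U j :=
  (le_iSup (fun e : 𝓤.E i j => 𝓤.V e) e).trans (𝓤.iSup_V i j).le

/-- The intersection `V_e ∩ V_{e'} ∩ V_{e''}`, used for `e`, `e'`, `e''` over `(i, j)`, `(j, k)`,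
`(i, k)`. -/
abbrev W {i j k : 𝓤.ι} (e : 𝓤.E i j) (e' : 𝓤.E j k) (e'' : 𝓤.E i k) : Opens X :=
  𝓤.V e ⊓ 𝓤.V e' ⊓ 𝓤.V e''

variable {𝓤} {i j k : 𝓤.ι} (e : 𝓤.E i j) (e' : 𝓤.E j k) (e'' : 𝓤.E i k)

lemma W_le₁ : 𝓤.W e e' e'' ≤ 𝓤.V e := inf_le_left.trans inf_le_left

lemma W_le₂ : 𝓤.W e e' e'' ≤ 𝓤.V e' := inf_le_left.trans inf_le_right

lemma W_le₃ : 𝓤.W e e' e'' ≤ 𝓤.V e'' := inf_le_right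

end HyperCover

/-- `η ∈ H²(X, F)` is the cohomology class of the 2-cochain `a_{ijk} ∈ F(V_e ∩ V_{e'} ∩ V_{e''})`
(which is then a cocycle): there are a short exact sequence `0 ⟶ F ⟶ I ⟶ Q ⟶ 0` and
`s_{ij} ∈ I(V_e)` with `a_{ijk} = s_{ij} + s_{jk} - s_{ik}`, such that the images of the `s_{ij}`
in `Q` come from a cocycle `q_{ij} ∈ Q(U_i ∩ U_j)` and `η` is the image under the connecting
homomorphism of the class of `(q_{ij})`. -/
def RepresentsH2 (F : AbSheaf X) {𝓤 : HyperCover X}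
    (a : ∀ {i j k} (e : 𝓤.E i j) (e' : 𝓤.E j k) (e'' : 𝓤.E i k), F.sec (𝓤.W e e' e''))
    (η : Sheaf.H F 2) : Prop :=
  ∃ (I Q : AbSheaf X) (f : F ⟶ I) (g : I ⟶ Q) (w : f ≫ g = 0)
    (hS : (ShortComplex.mk f g w).ShortExact) (s : ∀ {i j} (e : 𝓤.E i j), I.sec (𝓤.V e))
    (q : ∀ i j, Q.sec (𝓤.U i ⊓ 𝓤.U j)) (κ : Sheaf.H Q 1),
    (∀ {i j k} (e : 𝓤.E i j) (e' : 𝓤.E j k) (e'' : 𝓤.E i k),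
      AbSheaf.app f _ (a e e' e'') =
        I.res (HyperCover.W_le₁ e e' e'') (s e) + I.res (HyperCover.W_le₂ e e' e'') (s e') -
          I.res (HyperCover.W_le₃ e e' e'') (s e'')) ∧
    (∀ {i j} (e : 𝓤.E i j), AbSheaf.app g (𝓤.V e) (s e) = Q.res (𝓤.V_le e) (q i j)) ∧
    RepresentsH1 Q (𝓤 := 𝓤.toOpenCover) q κ ∧
    η = connecting hS 1 κ

/-! ### The maps of the long exact sequence of an extension of sheaves of groups

Throughout, `1 ⟶ A ⟶ B ⟶ C ⟶ 1` is an extension of sheaves of groups, with `A` commutative (and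
central for the connecting map to `H²`). -/

variable {A B C : GrpSheaf X} (hA : A.IsComm) (i : A ⟶ B) (p : B ⟶ C)

/-- `η ∈ H¹(X, A)` is the cohomology class of the cocycle `γ` with values in the commutative sheaf
of groups `A`. -/
def IsClassOf {𝓤 : OpenCover X} (γ : Cocycle A 𝓤) (η : Sheaf.H (A.toAb hA) 1) : Prop :=
  RepresentsH1 (A.toAb hA) (fun i j => A.toAbSec hA _ (Additive.ofMul (γ.val i j))) η

/-- The map `H⁰(X, A) → H⁰(X, B) = B(X)` induced by `i`. -/
noncomputable def mapH0 : Sheaf.H (A.toAb hA) 0 → B.sec ⊤ :=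
  fun θ => GrpSheaf.app i ⊤
    (Additive.toMul ((A.toAbSec hA ⊤).symm ((classH0 (A.toAb hA)).symm θ)))

/-- `φ` is the map `H¹(X, A) → Ȟ¹(X, B)` induced by `i`: it sends the class of a cocycle `γ` to the
class of `i(γ)`. -/
def IsMapH1 (φ : Sheaf.H (A.toAb hA) 1 → CechH1 B) : Prop :=
  ∀ η ξ, φ η = ξ ↔
    ∃ (𝓤 : OpenCover X) (γ : Cocycle A 𝓤), IsClassOf hA γ η ∧ ξ = (Cocycle.map i γ).cls

/-- `δ` is the connecting map `H⁰(X, C) → H¹(X, A)`: it sends a global section `c` with local lifts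
`g_i ∈ B(U_i)` to the class of the cocycle `g_i g_j⁻¹`. -/
def IsConnecting₁ (δ : C.sec ⊤ → Sheaf.H (A.toAb hA) 1) : Prop :=
  ∀ c η, δ c = η ↔
    ∃ (𝓤 : OpenCover X) (b : ∀ r, B.sec (𝓤.U r)) (γ : Cocycle A 𝓤),
      (∀ r, GrpSheaf.app p (𝓤.U r) (b r) = C.res le_top c) ∧
      (∀ r s, GrpSheaf.app i (𝓤.U r ⊓ 𝓤.U s) (γ.val r s) =
        B.res inf_le_left (b r) * (B.res inf_le_right (b s))⁻¹) ∧
      IsClassOf hA γ η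

/-- `δ` is the connecting map `Ȟ¹(X, C) → H²(X, A)`: it sends the class of a cocycle `c_{ij}` with
local lifts `b_{ij}`, defined on the members of open coverings of the intersections `U_i ∩ U_j`, to
the class of the 2-cocycle `b_{ij} b_{jk} b_{ik}⁻¹`. -/
def IsConnecting₂ (δ : CechH1 C → Sheaf.H (A.toAb hA) 2) : Prop :=
  ∀ ξ η, δ ξ = η ↔
    ∃ (𝓤 : HyperCover X) (c : Cocycle C 𝓤.toOpenCover)
      (b : ∀ {r s} (e : 𝓤.E r s), B.sec (𝓤.V e))
      (a : ∀ {r s t} (e : 𝓤.E r s) (e' : 𝓤.E s t) (e'' : 𝓤.E r t), A.sec (𝓤.W e e' e'')),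
      ξ = Cocycle.cls c ∧
      (∀ {r s} (e : 𝓤.E r s),
        GrpSheaf.app p (𝓤.V e) (b e) = C.res (𝓤.V_le e) (Cocycle.val c r s)) ∧
      (∀ {r s t} (e : 𝓤.E r s) (e' : 𝓤.E s t) (e'' : 𝓤.E r t),
        GrpSheaf.app i _ (a e e' e'') =
          B.res (HyperCover.W_le₁ e e' e'') (b e) * B.res (HyperCover.W_le₂ e e' e'') (b e') *
            (B.res (HyperCover.W_le₃ e e' e'') (b e''))⁻¹) ∧
      RepresentsH2 (A.toAb hA) (fun e e' e'' => A.toAbSec hA _ (Additive.ofMul (a e e' e''))) η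

end AQSeries

namespace AQSeries

variable {X : TopCat.{u}}

/-! ### Sections of sheaves and of quotient sheaves -/

section
variable (G : GrpSheaf X) {U V W : Opens X}

lemma GrpSheaf.res_res (h : V ≤ U) (h' : W ≤ V) (s : G.sec U) :
    G.res h' (G.res h s) = G.res (h'.trans h) s := by
  change (G.obj.map _ ≫ G.obj.map _).hom s = _
  rw [← Functor.map_comp]; rfl

lemma GrpSheaf.res_self (h : U ≤ U) (s : G.sec U) : G.res h s = s :=
  ConcreteCategory.congr_hom (G.obj.map_id (op U)) s

lemma GrpSheaf.app_res {G G' : GrpSheaf X} (f : G ⟶ G') (h : V ≤ U) (s : G.sec U) :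
    GrpSheaf.app f V (G.res h s) = G'.res h (GrpSheaf.app f U s) :=
  ConcreteCategory.congr_hom (f.hom.naturality (homOfLE h).op) s

lemma GrpSheaf.sec_ext {s t : G.sec U}
    (H : ∀ x ∈ U, ∃ (V : Opens X) (h : V ≤ U), x ∈ V ∧ G.res h s = G.res h t) : s = t := by
  choose V hV hx e using H
  exact TopCat.Sheaf.eq_of_locally_eq' (F := G) (fun x : U => V x.1 x.2) U
    (fun x => homOfLE (hV x.1 x.2))
    (fun x hxU => Opens.mem_iSup.2 ⟨⟨x, hxU⟩, hx x hxU⟩) s t (fun x => e x.1 x.2)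

lemma GrpSheaf.glue {ι : Type*} (V : ι → Opens X) (hV : ∀ i, V i ≤ U) (hU : U ≤ ⨆ i, V i)
    (s : ∀ i, G.sec (V i))
    (hs : ∀ i j, G.res (inf_le_left : V i ⊓ V j ≤ V i) (s i) = G.res inf_le_right (s j)) :
    ∃ t : G.sec U, ∀ i, G.res (hV i) t = s i :=
  (TopCat.Sheaf.existsUnique_gluing' (F := G) V U (fun i => homOfLE (hV i)) hU s hs).exists
end

section
variable (G : AbSheaf X) {U V W : Opens X}

lemma AbSheaf.res_res (h : V ≤ U) (h' : W ≤ V) (s : G.sec U) :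
    G.res h' (G.res h s) = G.res (h'.trans h) s := by
  change (G.obj.map _ ≫ G.obj.map _).hom s = _
  rw [← Functor.map_comp]; rfl

lemma AbSheaf.app_res {G G' : AbSheaf X} (f : G ⟶ G') (h : V ≤ U) (s : G.sec U) :
    AbSheaf.app f V (G.res h s) = G'.res h (AbSheaf.app f U s) :=
  ConcreteCategory.congr_hom (f.hom.naturality (homOfLE h).op) s

lemma AbSheaf.sec_ext {s t : G.sec U}
    (H : ∀ x ∈ U, ∃ (V : Opens X) (h : V ≤ U), x ∈ V ∧ G.res h s = G.res h t) : s = t := by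
  choose V hV hx e using H
  exact TopCat.Sheaf.eq_of_locally_eq' (F := G) (fun x : U => V x.1 x.2) U
    (fun x => homOfLE (hV x.1 x.2))
    (fun x hxU => Opens.mem_iSup.2 ⟨⟨x, hxU⟩, hx x hxU⟩) s t (fun x => e x.1 x.2)

lemma AbSheaf.glue {ι : Type*} (V : ι → Opens X) (hV : ∀ i, V i ≤ U) (hU : U ≤ ⨆ i, V i)
    (s : ∀ i, G.sec (V i))
    (hs : ∀ i j, G.res (inf_le_left : V i ⊓ V j ≤ V i) (s i) = G.res inf_le_right (s j)) :
    ∃ t : G.sec U, ∀ i, G.res (hV i) t = s i :=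
  (TopCat.Sheaf.existsUnique_gluing' (F := G) V U (fun i => homOfLE (hV i)) hU s hs).exists

variable {S : ShortComplex (AbSheaf X)} (hS : S.ShortExact)
include hS
lemma AbSheaf.app_injective : Function.Injective (AbSheaf.app S.f U) := by
  have := hS.mono_f
  have : Mono ((sheafToPresheaf (Opens.grothendieckTopology X) AddCommGrpCat.{u} ⋙
    (evaluation _ _).obj (op U)).map S.f) := inferInstance
  exact (AddCommGrpCat.mono_iff_injective _).1 this

lemma AbSheaf.exists_app_eq (t : S.X₂.sec U) (ht : AbSheaf.app S.g U t = 0) :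
    ∃ s, AbSheaf.app S.f U s = t := by
  have := hS.mono_f
  have e := hS.exact.map_of_mono_of_preservesKernel
    (sheafToPresheaf (Opens.grothendieckTopology X) AddCommGrpCat.{u} ⋙
      (evaluation _ _).obj (op U)) inferInstance inferInstance
  rw [ShortComplex.ab_exact_iff] at e
  exact e t ht

lemma AbSheaf.exists_local_lift (q : S.X₃.sec U) (x : X) (hx : x ∈ U) :
    ∃ (V : Opens X) (h : V ≤ U) (t : S.X₂.sec V), x ∈ V ∧ AbSheaf.app S.g V t = S.X₃.res h q := by
  obtain ⟨V, h, ⟨s, hs⟩, hV⟩ := (TopCat.Presheaf.isLocallySurjective_iff _).1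
    ((TopCat.Sheaf.isLocallySurjective_iff_epi (X := X) S.g).2 hS.epi_g) U q x hx
  exact ⟨V, h, s, hV, hs⟩
end

namespace NormalSeries
variable (𝓗 : NormalSeries X) {k j l m : ℕ} {U V : Opens X}

/-- The section of `𝓗_k / 𝓗_j` defined by a section of `𝓗_k`. -/
noncomputable def quotMk (k j : ℕ) (U : Opens X) : 𝓗.grp k U →* (𝓗.quot k j).sec U :=
  ((toSheafify (Opens.grothendieckTopology X) (𝓗.quotPresheaf k j)).app (op U)).hom.comp
    (QuotientGroup.mk' (𝓗.sub k j U))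

lemma quotMap_quotMk (hk : l ≤ k) (hj : m ≤ j) (s : 𝓗.grp k U) :
    GrpSheaf.app (𝓗.quotMap hk hj) U (𝓗.quotMk k j U s) =
      𝓗.quotMk l m U (Subgroup.inclusion (𝓗.le hk U) s) :=
  (ConcreteCategory.congr_hom (NatTrans.congr_app (toSheafify_naturality
    (Opens.grothendieckTopology X) (𝓗.quotPresheafMap hk hj)) (op U))
    (QuotientGroup.mk s)).symm

lemma exists_quotMk (s : (𝓗.quot k j).sec U) (x : X) (hx : x ∈ U) :
    ∃ (V : Opens X) (h : V ≤ U) (t : 𝓗.grp k V), x ∈ V ∧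
      𝓗.quotMk k j V t = (𝓗.quot k j).res h s := by
  have : Presheaf.IsLocallySurjective (Opens.grothendieckTopology X)
    (toSheafify (Opens.grothendieckTopology X) (𝓗.quotPresheaf k j)) := inferInstance
  obtain ⟨V, h, ⟨t, ht⟩, hV⟩ := this.imageSieve_mem s x hx
  obtain ⟨t, rfl⟩ := QuotientGroup.mk_surjective t
  exact ⟨V, leOfHom h, t, hV, ht⟩

lemma quotMk_eq_one_iff (s : 𝓗.grp k U) :
    𝓗.quotMk k j U s = 1 ↔ s.1 ∈ (𝓗.H j).carrier U := by
  constructor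
  · intro hs
    have : Presheaf.IsLocallyInjective (Opens.grothendieckTopology X)
      (toSheafify (Opens.grothendieckTopology X) (𝓗.quotPresheaf k j)) := inferInstance
    have hs' : ((toSheafify (Opens.grothendieckTopology X) (𝓗.quotPresheaf k j)).app (op U)).hom
      (QuotientGroup.mk s) = ((toSheafify (Opens.grothendieckTopology X)
        (𝓗.quotPresheaf k j)).app (op U)).hom (QuotientGroup.mk 1) := by
      refine Eq.trans hs (map_one _).symm
    refine (𝓗.H j).local_mem U s.1 fun x hx => ?_
    obtain ⟨V, h, hV, hxV⟩ := this.equalizerSieve_mem _ _ hs' x hx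
    refine ⟨V, leOfHom h, hxV, ?_⟩
    have e : (QuotientGroup.mk (𝓗.grpRes k (leOfHom h) s) : 𝓗.grp k V ⧸ 𝓗.sub k j V) =
      QuotientGroup.mk 1 := hV.trans (map_one _)
    exact (QuotientGroup.eq_one_iff (N := 𝓗.sub k j V) _).1 e
  · intro hs
    have e : (QuotientGroup.mk s : 𝓗.grp k U ⧸ 𝓗.sub k j U) = 1 := (QuotientGroup.eq_one_iff _).2 hs
    exact (congrArg ((toSheafify (Opens.grothendieckTopology X)
      (𝓗.quotPresheaf k j)).app (op U)).hom e).trans (map_one _)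

lemma quotMap_quotMap {k' j' k'' j'' : ℕ} (hk : k' ≤ k) (hj : j' ≤ j) (hk' : k'' ≤ k')
    (hj' : j'' ≤ j') (s : (𝓗.quot k j).sec U) :
    GrpSheaf.app (𝓗.quotMap hk' hj') U (GrpSheaf.app (𝓗.quotMap hk hj) U s) =
      GrpSheaf.app (𝓗.quotMap (hk'.trans hk) (hj'.trans hj)) U s := by
  refine GrpSheaf.sec_ext _ fun x hx => ?_
  obtain ⟨V, h, t, hxV, ht⟩ := 𝓗.exists_quotMk s x hx
  refine ⟨V, h, hxV, ?_⟩
  rw [← GrpSheaf.app_res, ← GrpSheaf.app_res, ← GrpSheaf.app_res, ← ht, quotMap_quotMk,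
    quotMap_quotMk, quotMap_quotMk]
  rfl

lemma quotMap_self (s : (𝓗.quot k j).sec U) :
    GrpSheaf.app (𝓗.quotMap (le_refl k) (le_refl j)) U s = s := by
  refine GrpSheaf.sec_ext _ fun x hx => ?_
  obtain ⟨V, h, t, hxV, ht⟩ := 𝓗.exists_quotMk s x hx
  refine ⟨V, h, hxV, ?_⟩
  rw [← GrpSheaf.app_res, ← ht, quotMap_quotMk]
  rfl

lemma quotMap_injective (hk : l ≤ k) :
    Function.Injective (GrpSheaf.app (𝓗.quotMap hk (le_refl j)) U) := by
  rw [injective_iff_map_eq_one]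
  intro s hs
  refine GrpSheaf.sec_ext _ fun x hx => ?_
  obtain ⟨V, h, t, hxV, ht⟩ := 𝓗.exists_quotMk s x hx
  refine ⟨V, h, hxV, ?_⟩
  have e := GrpSheaf.app_res (𝓗.quotMap hk (le_refl j)) h s
  rw [hs, map_one, ← ht, quotMap_quotMk, quotMk_eq_one_iff] at e
  rw [map_one, ← ht, quotMk_eq_one_iff]
  exact e

lemma exists_local_quotMap_eq (hj : m ≤ j) (s : (𝓗.quot k m).sec U) (x : X) (hx : x ∈ U) :
    ∃ (V : Opens X) (h : V ≤ U) (t : (𝓗.quot k j).sec V), x ∈ V ∧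
      GrpSheaf.app (𝓗.quotMap (le_refl k) hj) V t = (𝓗.quot k m).res h s := by
  obtain ⟨V, h, t, hxV, ht⟩ := 𝓗.exists_quotMk s x hx
  exact ⟨V, h, 𝓗.quotMk k j V t, hxV, by rw [← ht, quotMap_quotMk]; rfl⟩

/-- Exactness of `𝓗_k / 𝓗_j ⟶ 𝓗_l / 𝓗_j ⟶ 𝓗_l / 𝓗_k` on sections. -/
lemma exists_quotMap_eq (hk : l ≤ k) (hj : k ≤ j) (s : (𝓗.quot l j).sec U)
    (hs : GrpSheaf.app (𝓗.quotMap (le_refl l) hj) U s = 1) :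
    ∃ t : (𝓗.quot k j).sec U, GrpSheaf.app (𝓗.quotMap hk (le_refl j)) U t = s := by
  have loc : ∀ x : U, ∃ (V : Opens X) (h : V ≤ U) (t : (𝓗.quot k j).sec V), x.1 ∈ V ∧
      GrpSheaf.app (𝓗.quotMap hk (le_refl j)) V t = (𝓗.quot l j).res h s := by
    rintro ⟨x, hx⟩
    obtain ⟨V, h, t, hxV, ht⟩ := 𝓗.exists_quotMk s x hx
    have e := GrpSheaf.app_res (𝓗.quotMap (le_refl l) hj) h s
    rw [hs, map_one, ← ht, quotMap_quotMk, quotMk_eq_one_iff] at e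
    refine ⟨V, h, 𝓗.quotMk k j V ⟨t.1, e⟩, hxV, ?_⟩
    rw [quotMap_quotMk, ← ht]
    rfl
  choose V hV t hx ht using loc
  obtain ⟨t', ht'⟩ := GrpSheaf.glue (𝓗.quot k j) V hV
    (fun x hxU => Opens.mem_iSup.2 ⟨⟨x, hxU⟩, hx ⟨x, hxU⟩⟩) t (fun i i' => by
      apply 𝓗.quotMap_injective hk
      rw [GrpSheaf.app_res, GrpSheaf.app_res, ht, ht, GrpSheaf.res_res, GrpSheaf.res_res])
  refine ⟨t', GrpSheaf.sec_ext _ fun x hxU => ⟨V ⟨x, hxU⟩, hV _, hx _, ?_⟩⟩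
  rw [← GrpSheaf.app_res, ht', ht]

lemma quotMap_eq_one (hk : m ≤ k) (hj : m ≤ j) (hl : l ≤ k) (s : (𝓗.quot k j).sec U) :
    GrpSheaf.app (𝓗.quotMap hl hj) U s = 1 := by
  refine GrpSheaf.sec_ext _ fun x hx => ?_
  obtain ⟨V, h, t, hxV, ht⟩ := 𝓗.exists_quotMk s x hx
  refine ⟨V, h, hxV, ?_⟩
  rw [← GrpSheaf.app_res, ← ht, quotMap_quotMk, map_one, quotMk_eq_one_iff]
  exact 𝓗.le hk V t.2

lemma IsCentralAt.mono {k l j : ℕ} (hl : l < j) (h : 𝓗.IsCentralAt hl) (hlk : l ≤ k) (hk : k < j) :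
    𝓗.IsCentralAt hk := by
  intro U a b
  apply 𝓗.quotMap_injective hlk
  rw [map_mul, map_mul, quotMap_quotMap]
  exact h U a _
end NormalSeries

/-! ### Short exact sequences of sheaves of abelian groups -/

/-- The short complex `0 ⟶ F ⟶ I ⟶ coker ⟶ 0` of a morphism `F ⟶ I`. -/
noncomputable abbrev cokernelComplex {F I : AbSheaf X} (f : F ⟶ I) : ShortComplex (AbSheaf X) :=
  ShortComplex.mk f (Limits.cokernel.π f) (Limits.cokernel.condition f)

lemma cokernelComplex_shortExact {F I : AbSheaf X} (f : F ⟶ I) [Mono f] :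
    (cokernelComplex f).ShortExact where
  exact := ShortComplex.exact_cokernel f
  mono_f := inferInstanceAs (Mono f)
  epi_g := inferInstanceAs (Epi (Limits.cokernel.π f))

/-- An embedding of a sheaf of abelian groups in an injective one. -/
noncomputable abbrev injectiveComplex (F : AbSheaf X) : ShortComplex (AbSheaf X) :=
  cokernelComplex (Injective.ι F)

lemma injectiveComplex_shortExact (F : AbSheaf X) : (injectiveComplex F).ShortExact :=
  cokernelComplex_shortExact _

lemma exists_hom_of_injective {S S' : ShortComplex (AbSheaf X)} (hS : S.ShortExact)
    [Injective S'.X₂] (φ : S.X₁ ⟶ S'.X₁) : ∃ Φ : S ⟶ S', Φ.τ₁ = φ := by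
  have := hS.mono_f
  have := hS.epi_g
  have e : S.f ≫ Injective.factorThru (φ ≫ S'.f) S.f = φ ≫ S'.f := Injective.comp_factorThru _ _
  refine ⟨⟨φ, Injective.factorThru (φ ≫ S'.f) S.f,
    hS.exact.desc (Injective.factorThru (φ ≫ S'.f) S.f ≫ S'.g) ?_, e.symm, ?_⟩, rfl⟩
  · rw [← Category.assoc, e, Category.assoc, S'.zero, Limits.comp_zero]
  · exact (hS.exact.g_desc _ _).symm

section
variable {S : ShortComplex (AbSheaf X)} (hS : S.ShortExact) {n : ℕ}

lemma connecting_sub (x y : Sheaf.H S.X₃ n) :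
    connecting hS n (x - y) = connecting hS n x - connecting hS n y :=
  map_sub (hS.extClass.postcomp _ rfl) x y

lemma connecting_naturality {S' : ShortComplex (AbSheaf X)} (hS' : S'.ShortExact) (Φ : S ⟶ S')
    (x : Sheaf.H S.X₃ n) :
    Sheaf.H.map Φ.τ₁ (n + 1) (connecting hS n x) = connecting hS' n (Sheaf.H.map Φ.τ₃ n x) := by
  rw [Sheaf.H.map_apply, Sheaf.H.map_apply, connecting, connecting,
    Abelian.Ext.comp_assoc _ _ _ rfl (add_zero 1) rfl,
    ShortComplex.ShortExact.extClass_naturality hS hS' Φ,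
    Abelian.Ext.comp_assoc _ _ _ (add_zero n) (zero_add 1) rfl]

lemma connecting_map_g (y : Sheaf.H S.X₂ n) :
    connecting hS n (Sheaf.H.map S.g n y) = 0 := by
  rw [Sheaf.H.map_apply, connecting,
    Abelian.Ext.comp_assoc _ _ _ (add_zero n) (zero_add 1) rfl, hS.comp_extClass,
    Abelian.Ext.comp_zero]

lemma exists_of_connecting_eq_zero {x : Sheaf.H S.X₃ n} (h : connecting hS n x = 0) :
    ∃ y, Sheaf.H.map S.g n y = x :=
  Abelian.Ext.covariant_sequence_exact₃ _ hS x rfl h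

lemma connecting_surjective_of_injective [Injective S.X₂] :
    Function.Surjective (connecting hS n) := fun x =>
  Abelian.Ext.covariant_sequence_exact₁ _ hS x (Abelian.Ext.eq_zero_of_injective _) rfl
end

lemma map_classH0 {F F' : AbSheaf X} (φ : F ⟶ F') (s : F.sec ⊤) :
    Sheaf.H.map φ 0 (classH0 F s) = classH0 F' (AbSheaf.app φ ⊤ s) :=
  Sheaf.H.equiv₀_symm_naturality Limits.isTerminalTop φ s

/-! ### The sheaf of discontinuous sections -/

/-- The stalk of a sheaf of abelian groups. -/
noncomputable abbrev AbSheaf.stalk (F : AbSheaf X) (x : X) : Type u :=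
  TopCat.Presheaf.stalk (X := X) (C := AddCommGrpCat.{u}) F.obj x

/-- The germ of a section. -/
noncomputable def AbSheaf.germ (F : AbSheaf X) {U : Opens X} {x : X} (hx : x ∈ U) :
    F.sec U →+ F.stalk x :=
  (TopCat.Presheaf.germ (X := X) (C := AddCommGrpCat.{u}) F.obj U x hx).hom

lemma AbSheaf.germ_res (F : AbSheaf X) {U V : Opens X} (h : V ≤ U) {x : X} (hx : x ∈ V)
    (s : F.sec U) : F.germ hx (F.res h s) = F.germ (h hx) s :=
  TopCat.Presheaf.germ_res_apply (X := X) (C := AddCommGrpCat.{u}) F.obj (homOfLE h) x hx s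

/-- The sheaf of families of germs of a sheaf of abelian groups. -/
noncomputable def godement (F : AbSheaf X) : AbSheaf X where
  obj :=
    { obj := fun U => AddCommGrpCat.of (∀ x : U.unop, F.stalk x.1)
      map := fun {U V} i => AddCommGrpCat.ofHom
        { toFun := fun (v : ∀ x : U.unop, F.stalk x.1) (x : V.unop) => v ⟨x.1, leOfHom i.unop x.2⟩
          map_zero' := rfl
          map_add' := fun _ _ => rfl } }
  property := by
    rw [Presheaf.isSheaf_iff_isSheaf_forget _ _ (CategoryTheory.forget AddCommGrpCat.{u})]
    exact TopCat.Presheaf.toTypes_isSheaf X fun x => F.stalk x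

/-- The section of the sheaf of families of germs defined by a family of germs. -/
noncomputable def godementMk (F : AbSheaf X) (U : Opens X) :
    (∀ x : U, F.stalk x.1) ≃+ (godement F).sec U := AddEquiv.refl _

/-- The embedding of a sheaf of abelian groups in its sheaf of families of germs. -/
noncomputable def toGodement (F : AbSheaf X) : F ⟶ godement F where
  hom :=
    { app := fun U => AddCommGrpCat.ofHom ((godementMk F U.unop).toAddMonoidHom.comp
        { toFun := fun s x => F.germ x.2 s
          map_zero' := funext fun x => map_zero _
          map_add' := fun _ _ => funext fun x => map_add _ _ _ })
      naturality := fun U V i => by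
        refine AddCommGrpCat.hom_ext (AddMonoidHom.ext fun s => funext fun x => ?_)
        exact F.germ_res (leOfHom i.unop) x.2 s }

lemma toGodement_injective (F : AbSheaf X) (U : Opens X) :
    Function.Injective (AbSheaf.app (toGodement F) U) := by
  intro s t h
  refine AbSheaf.sec_ext F fun x hx => ?_
  obtain ⟨W, hxW, i, i', e⟩ := TopCat.Presheaf.germ_eq (X := X) (C := AddCommGrpCat.{u}) F.obj x
    hx hx s t (congrFun h (⟨x, hx⟩ : U))
  exact ⟨W, leOfHom i, hxW, e⟩

instance (F : AbSheaf X) : Mono (toGodement F) := by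
  have : Mono (toGodement F).hom := by
    rw [NatTrans.mono_iff_mono_app]
    exact fun U => (AddCommGrpCat.mono_iff_injective _).2 (toGodement_injective F U.unop)
  exact (sheafToPresheaf _ _).mono_of_mono_map this

/-! ### Čech cocycles and cohomology classes in degree one -/

/-- The instance of `RepresentsH1` for a fixed short exact sequence. -/
def RepresentsH1In {S : ShortComplex (AbSheaf X)} (hS : S.ShortExact) {𝓤 : OpenCover X}
    (a : ∀ i j, S.X₁.sec (𝓤.U i ⊓ 𝓤.U j)) (η : Sheaf.H S.X₁ 1) : Prop :=
  ∃ (q : S.X₃.sec ⊤) (t : ∀ i, S.X₂.sec (𝓤.U i)),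
    (∀ i, AbSheaf.app S.g (𝓤.U i) (t i) = S.X₃.res le_top q) ∧
    (∀ i j, AbSheaf.app S.f (𝓤.U i ⊓ 𝓤.U j) (a i j) =
      S.X₂.res inf_le_left (t i) - S.X₂.res inf_le_right (t j)) ∧
    η = connecting hS 0 (classH0 S.X₃ q)

section
variable {𝓤 : OpenCover X}

lemma RepresentsH1In.representsH1 {S : ShortComplex (AbSheaf X)} {hS : S.ShortExact}
    {a : ∀ i j, S.X₁.sec (𝓤.U i ⊓ 𝓤.U j)} {η : Sheaf.H S.X₁ 1} (h : RepresentsH1In hS a η) :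
    RepresentsH1 S.X₁ a η :=
  ⟨_, _, _, _, _, hS, h⟩

lemma RepresentsH1In.map {S S' : ShortComplex (AbSheaf X)} {hS : S.ShortExact}
    {a : ∀ i j, S.X₁.sec (𝓤.U i ⊓ 𝓤.U j)} {η : Sheaf.H S.X₁ 1} (h : RepresentsH1In hS a η)
    (hS' : S'.ShortExact) (Φ : S ⟶ S') :
    RepresentsH1In hS' (fun i j => AbSheaf.app Φ.τ₁ _ (a i j)) (Sheaf.H.map Φ.τ₁ 1 η) := by
  obtain ⟨q, t, h₁, h₂, rfl⟩ := h
  have eg : ∀ U s, AbSheaf.app S'.g U (AbSheaf.app Φ.τ₂ U s) =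
      AbSheaf.app Φ.τ₃ U (AbSheaf.app S.g U s) := fun U s =>
    ConcreteCategory.congr_hom (congrArg (fun f => f.hom.app (op U)) Φ.comm₂₃) s
  have ef : ∀ U s, AbSheaf.app S'.f U (AbSheaf.app Φ.τ₁ U s) =
      AbSheaf.app Φ.τ₂ U (AbSheaf.app S.f U s) := fun U s =>
    ConcreteCategory.congr_hom (congrArg (fun f => f.hom.app (op U)) Φ.comm₁₂) s
  refine ⟨AbSheaf.app Φ.τ₃ ⊤ q, fun i => AbSheaf.app Φ.τ₂ _ (t i), fun i => ?_, fun i j => ?_, ?_⟩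
  · rw [eg, h₁, AbSheaf.app_res]
  · rw [ef, h₂, map_sub, AbSheaf.app_res, AbSheaf.app_res]
  · rw [connecting_naturality hS hS', map_classH0]

lemma RepresentsH1In.sub {S : ShortComplex (AbSheaf X)} {hS : S.ShortExact}
    {a a' : ∀ i j, S.X₁.sec (𝓤.U i ⊓ 𝓤.U j)} {η η' : Sheaf.H S.X₁ 1}
    (h : RepresentsH1In hS a η) (h' : RepresentsH1In hS a' η') :
    RepresentsH1In hS (fun i j => a i j - a' i j) (η - η') := by
  obtain ⟨q, t, h₁, h₂, rfl⟩ := h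
  obtain ⟨q', t', h₁', h₂', rfl⟩ := h'
  refine ⟨q - q', fun i => t i - t' i, fun i => ?_, fun i j => ?_, ?_⟩
  · rw [map_sub, map_sub, h₁, h₁']
  · rw [map_sub, map_sub, map_sub, h₂, h₂']
    abel
  · rw [map_sub, connecting_sub]

lemma RepresentsH1.inInjective {F F' : AbSheaf X} {a : ∀ i j, F.sec (𝓤.U i ⊓ 𝓤.U j)}
    {η : Sheaf.H F 1} (h : RepresentsH1 F a η) (φ : F ⟶ F') :
    RepresentsH1In (injectiveComplex_shortExact F') (fun i j => AbSheaf.app φ _ (a i j))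
      (Sheaf.H.map φ 1 η) := by
  obtain ⟨I, Q, f, g, w, hS, h⟩ := h
  obtain ⟨Φ, rfl⟩ := exists_hom_of_injective (S' := injectiveComplex F') hS φ
  exact RepresentsH1In.map (S := ShortComplex.mk f g w) (hS := hS) h _ Φ

lemma RepresentsH1.map {F F' : AbSheaf X} {a : ∀ i j, F.sec (𝓤.U i ⊓ 𝓤.U j)}
    {η : Sheaf.H F 1} (h : RepresentsH1 F a η) (φ : F ⟶ F') :
    RepresentsH1 F' (fun i j => AbSheaf.app φ _ (a i j)) (Sheaf.H.map φ 1 η) :=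
  (h.inInjective φ).representsH1

lemma RepresentsH1.inInjective' {F : AbSheaf X} {a : ∀ i j, F.sec (𝓤.U i ⊓ 𝓤.U j)}
    {η : Sheaf.H F 1} (h : RepresentsH1 F a η) :
    RepresentsH1In (injectiveComplex_shortExact F) a η := by
  simpa only [Sheaf.H.map_id_apply] using! h.inInjective (𝟙 F)

lemma RepresentsH1.sub {F : AbSheaf X} {a a' : ∀ i j, F.sec (𝓤.U i ⊓ 𝓤.U j)}
    {η η' : Sheaf.H F 1} (h : RepresentsH1 F a η) (h' : RepresentsH1 F a' η') :
    RepresentsH1 F (fun i j => a i j - a' i j) (η - η') :=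
  (h.inInjective'.sub h'.inInjective').representsH1

lemma RepresentsH1.refine {F : AbSheaf X} {a : ∀ i j, F.sec (𝓤.U i ⊓ 𝓤.U j)}
    {η : Sheaf.H F 1} (h : RepresentsH1 F a η) {𝓥 : OpenCover X} {ρ : 𝓥.ι → 𝓤.ι}
    (hρ : 𝓥.Refines 𝓤 ρ) :
    RepresentsH1 F (𝓤 := 𝓥) (fun i j => F.res (inf_le_inf (hρ i) (hρ j)) (a (ρ i) (ρ j))) η := by
  obtain ⟨I, Q, f, g, w, hS, q, t, h₁, h₂, rfl⟩ := h
  refine ⟨I, Q, f, g, w, hS, q, fun i => I.res (hρ i) (t (ρ i)), fun i => ?_, fun i j => ?_, rfl⟩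
  · rw [AbSheaf.app_res, h₁, AbSheaf.res_res]
  · rw [AbSheaf.app_res, h₂, map_sub, AbSheaf.res_res, AbSheaf.res_res, AbSheaf.res_res,
      AbSheaf.res_res]

lemma RepresentsH1.eq_zero_iff {F : AbSheaf X} {a : ∀ i j, F.sec (𝓤.U i ⊓ 𝓤.U j)}
    {η : Sheaf.H F 1} (h : RepresentsH1 F a η) :
    η = 0 ↔ ∃ y : ∀ i, F.sec (𝓤.U i), ∀ i j,
      a i j = F.res inf_le_left (y i) - F.res inf_le_right (y j) := by
  obtain ⟨I, Q, f, g, w, hS, q, t, h₁, h₂, rfl⟩ := h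
  have hgf : ∀ U s, AbSheaf.app g U (AbSheaf.app f U s) = 0 := fun U s =>
    ConcreteCategory.congr_hom (congrArg (fun φ => φ.hom.app (op U)) w) s
  constructor
  · intro h
    obtain ⟨y, hy⟩ := exists_of_connecting_eq_zero hS h
    obtain ⟨s, rfl⟩ := (classH0 I).surjective y
    have hs : AbSheaf.app g ⊤ s = q := (classH0 Q).injective ((map_classH0 g s).symm.trans hy)
    have : ∀ i, ∃ y, AbSheaf.app f (𝓤.U i) y = t i - I.res le_top s := fun i =>
      AbSheaf.exists_app_eq hS _ (by
        change AbSheaf.app g _ _ = 0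
        rw [map_sub, h₁, AbSheaf.app_res, hs, sub_self])
    choose y hy using this
    refine ⟨y, fun i j => AbSheaf.app_injective hS ?_⟩
    change AbSheaf.app f _ _ = AbSheaf.app f _ _
    rw [h₂, map_sub, AbSheaf.app_res, AbSheaf.app_res, hy, hy, map_sub, map_sub, AbSheaf.res_res,
      AbSheaf.res_res, sub_sub_sub_cancel_right]
  · rintro ⟨y, hy⟩
    obtain ⟨s, hs⟩ := AbSheaf.glue I (U := ⊤) 𝓤.U (fun i => le_top) 𝓤.isOpenCover.ge
      (fun i => t i - AbSheaf.app f _ (y i)) (fun i j => by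
        have e := h₂ i j
        rw [hy, map_sub, AbSheaf.app_res, AbSheaf.app_res] at e
        rw [map_sub, map_sub, sub_eq_sub_iff_sub_eq_sub, ← e])
    have e : AbSheaf.app g ⊤ s = q := by
      refine AbSheaf.sec_ext Q fun x hx => ?_
      obtain ⟨i, hi⟩ := Opens.mem_iSup.1 (𝓤.isOpenCover.ge hx)
      refine ⟨𝓤.U i, le_top, hi, ?_⟩
      rw [← AbSheaf.app_res, hs, map_sub, h₁, hgf, sub_zero]
    rw [← e, ← map_classH0]
    exact connecting_map_g hS _

lemma RepresentsH1.unique {F : AbSheaf X} {a : ∀ i j, F.sec (𝓤.U i ⊓ 𝓤.U j)}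
    {η η' : Sheaf.H F 1} (h : RepresentsH1 F a η) (h' : RepresentsH1 F a η') : η = η' := by
  rw [← sub_eq_zero, (h.sub h').eq_zero_iff]
  exact ⟨fun i => 0, fun i j => by rw [sub_self, map_zero, map_zero, sub_self]⟩

lemma exists_representsH1 {F : AbSheaf X} (a : ∀ i j, F.sec (𝓤.U i ⊓ 𝓤.U j))
    (ha : ∀ i j k (T : Opens X) (hij : T ≤ 𝓤.U i ⊓ 𝓤.U j) (hjk : T ≤ 𝓤.U j ⊓ 𝓤.U k)
      (hik : T ≤ 𝓤.U i ⊓ 𝓤.U k), F.res hij (a i j) + F.res hjk (a j k) = F.res hik (a i k)) :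
    ∃ η, RepresentsH1 F a η := by
  have hS := cokernelComplex_shortExact (toGodement F)
  choose r hr using fun x : X => Opens.mem_iSup.1 (𝓤.isOpenCover.ge (Opens.mem_top x))
  let t : ∀ i, (godement F).sec (𝓤.U i) := fun i =>
    godementMk F _ fun x => F.germ (U := 𝓤.U i ⊓ 𝓤.U (r x.1)) ⟨x.2, hr x.1⟩ (a i (r x.1))
  have ht : ∀ i j, AbSheaf.app (toGodement F) (𝓤.U i ⊓ 𝓤.U j) (a i j) =
      (godement F).res inf_le_left (t i) - (godement F).res inf_le_right (t j) := by
    intro i j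
    refine funext fun (x : (𝓤.U i ⊓ 𝓤.U j : Opens X)) => ?_
    have hxT : x.1 ∈ 𝓤.U i ⊓ 𝓤.U j ⊓ 𝓤.U (r x.1) := ⟨x.2, hr x.1⟩
    have e := congrArg (F.germ hxT) (ha i j (r x.1) (𝓤.U i ⊓ 𝓤.U j ⊓ 𝓤.U (r x.1)) inf_le_left
        (inf_le_inf_right _ inf_le_right) (inf_le_inf_right _ inf_le_left))
    rw [map_add, AbSheaf.germ_res, AbSheaf.germ_res, AbSheaf.germ_res] at e
    exact eq_sub_of_add_eq e
  have hgf : ∀ U s, AbSheaf.app (cokernelComplex (toGodement F)).g U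
      (AbSheaf.app (toGodement F) U s) = 0 := fun U s =>
    ConcreteCategory.congr_hom (congrArg (fun φ => φ.hom.app (op U))
      (cokernelComplex (toGodement F)).zero) s
  obtain ⟨q, hq⟩ := AbSheaf.glue (cokernelComplex (toGodement F)).X₃ (U := ⊤) 𝓤.U (fun i => le_top)
    𝓤.isOpenCover.ge (fun i => AbSheaf.app (cokernelComplex (toGodement F)).g _ (t i))
    (fun i j => by
      have e := hgf _ (a i j)
      rw [ht, map_sub, sub_eq_zero] at e
      rw [← AbSheaf.app_res, ← AbSheaf.app_res]
      exact e)
  exact ⟨_, _, _, _, _, _, hS, q, t, fun i => (hq i).symm, ht, rfl⟩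

lemma exists_cocycle_representsH1 {F : AbSheaf X} (η : Sheaf.H F 1) :
    ∃ (𝓤 : OpenCover X) (a : ∀ i j, F.sec (𝓤.U i ⊓ 𝓤.U j)),
      (∀ i j k (T : Opens X) (hij : T ≤ 𝓤.U i ⊓ 𝓤.U j) (hjk : T ≤ 𝓤.U j ⊓ 𝓤.U k)
        (hik : T ≤ 𝓤.U i ⊓ 𝓤.U k), F.res hij (a i j) + F.res hjk (a j k) = F.res hik (a i k)) ∧
      RepresentsH1 F a η := by
  have hS := injectiveComplex_shortExact F
  have : Injective (injectiveComplex F).X₂ := inferInstanceAs (Injective (Injective.under F))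
  obtain ⟨κ, rfl⟩ := connecting_surjective_of_injective hS η
  obtain ⟨q, rfl⟩ := (classH0 _).surjective κ
  choose V hV t hx ht using fun x : X => AbSheaf.exists_local_lift hS q x (Opens.mem_top x)
  let 𝓤 : OpenCover X := ⟨X, V, top_le_iff.1 fun x _ => Opens.mem_iSup.2 ⟨x, hx x⟩⟩
  have : ∀ i j : X, ∃ a, AbSheaf.app (injectiveComplex F).f (V i ⊓ V j) a =
      AbSheaf.res _ inf_le_left (t i) - AbSheaf.res _ inf_le_right (t j) := fun i j =>
    AbSheaf.exists_app_eq hS _ (by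
      rw [map_sub, AbSheaf.app_res, AbSheaf.app_res, ht, ht, AbSheaf.res_res, AbSheaf.res_res,
        sub_self])
  choose a ha using this
  refine ⟨𝓤, a, fun i j k T hij hjk hik => AbSheaf.app_injective hS ?_,
    _, _, _, _, _, hS, q, t, ht, ha, rfl⟩
  rw [map_add, AbSheaf.app_res, AbSheaf.app_res, AbSheaf.app_res, ha, ha, ha]
  simp only [map_sub, AbSheaf.res_res]
  abel
end

/-! ### Čech cocycles and cohomology classes in degree two -/

/-- A refinement of an open covering with open coverings of the intersections. -/
structure HyperCover.Refinement (𝓥 𝓤 : HyperCover X) where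
  idx : 𝓥.ι → 𝓤.ι
  refines : 𝓥.toOpenCover.Refines 𝓤.toOpenCover idx
  edge : ∀ {i j : 𝓥.ι}, 𝓥.E i j → 𝓤.E (idx i) (idx j)
  V_le : ∀ {i j : 𝓥.ι} (e : 𝓥.E i j), 𝓥.V e ≤ 𝓤.V (edge e)

lemma HyperCover.Refinement.W_le {𝓥 𝓤 : HyperCover X} (ρ : 𝓥.Refinement 𝓤) {i j k : 𝓥.ι}
    (e : 𝓥.E i j) (e' : 𝓥.E j k) (e'' : 𝓥.E i k) :
    𝓥.W e e' e'' ≤ 𝓤.W (ρ.edge e) (ρ.edge e') (ρ.edge e'') :=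
  inf_le_inf (inf_le_inf (ρ.V_le e) (ρ.V_le e')) (ρ.V_le e'')

lemma HyperCover.exists_mem (𝓤 : HyperCover X) {i j : 𝓤.ι} {x : X} (hi : x ∈ 𝓤.U i)
    (hj : x ∈ 𝓤.U j) : ∃ e : 𝓤.E i j, x ∈ 𝓤.V e :=
  Opens.mem_iSup.1 ((𝓤.iSup_V i j).ge ⟨hi, hj⟩)

/-- The instance of `RepresentsH2` for a fixed short exact sequence. -/
def RepresentsH2In {S : ShortComplex (AbSheaf X)} (hS : S.ShortExact) {𝓤 : HyperCover X}
    (a : ∀ {i j k} (e : 𝓤.E i j) (e' : 𝓤.E j k) (e'' : 𝓤.E i k), S.X₁.sec (𝓤.W e e' e''))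
    (η : Sheaf.H S.X₁ 2) : Prop :=
  ∃ (s : ∀ {i j} (e : 𝓤.E i j), S.X₂.sec (𝓤.V e))
    (q : ∀ i j, S.X₃.sec (𝓤.U i ⊓ 𝓤.U j)) (κ : Sheaf.H S.X₃ 1),
    (∀ {i j k} (e : 𝓤.E i j) (e' : 𝓤.E j k) (e'' : 𝓤.E i k),
      AbSheaf.app S.f _ (a e e' e'') =
        S.X₂.res (HyperCover.W_le₁ e e' e'') (s e) + S.X₂.res (HyperCover.W_le₂ e e' e'') (s e') -
          S.X₂.res (HyperCover.W_le₃ e e' e'') (s e'')) ∧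
    (∀ {i j} (e : 𝓤.E i j), AbSheaf.app S.g (𝓤.V e) (s e) = S.X₃.res (𝓤.V_le e) (q i j)) ∧
    RepresentsH1 S.X₃ (𝓤 := 𝓤.toOpenCover) q κ ∧
    η = connecting hS 1 κ

section
variable {𝓤 : HyperCover X}

lemma RepresentsH2In.representsH2 {S : ShortComplex (AbSheaf X)} {hS : S.ShortExact}
    {a : ∀ {i j k} (e : 𝓤.E i j) (e' : 𝓤.E j k) (e'' : 𝓤.E i k), S.X₁.sec (𝓤.W e e' e'')}
    {η : Sheaf.H S.X₁ 2} (h : RepresentsH2In hS a η) : RepresentsH2 S.X₁ a η :=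
  ⟨_, _, _, _, _, hS, h⟩

lemma RepresentsH2In.map {S S' : ShortComplex (AbSheaf X)} {hS : S.ShortExact}
    {a : ∀ {i j k} (e : 𝓤.E i j) (e' : 𝓤.E j k) (e'' : 𝓤.E i k), S.X₁.sec (𝓤.W e e' e'')}
    {η : Sheaf.H S.X₁ 2} (h : RepresentsH2In hS a η) (hS' : S'.ShortExact) (Φ : S ⟶ S') :
    RepresentsH2In hS' (fun e e' e'' => AbSheaf.app Φ.τ₁ _ (a e e' e''))
      (Sheaf.H.map Φ.τ₁ 2 η) := by
  obtain ⟨s, q, κ, h₁, h₂, h₃, rfl⟩ := h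
  have eg : ∀ U s, AbSheaf.app S'.g U (AbSheaf.app Φ.τ₂ U s) =
      AbSheaf.app Φ.τ₃ U (AbSheaf.app S.g U s) := fun U s =>
    ConcreteCategory.congr_hom (congrArg (fun f => f.hom.app (op U)) Φ.comm₂₃) s
  have ef : ∀ U s, AbSheaf.app S'.f U (AbSheaf.app Φ.τ₁ U s) =
      AbSheaf.app Φ.τ₂ U (AbSheaf.app S.f U s) := fun U s =>
    ConcreteCategory.congr_hom (congrArg (fun f => f.hom.app (op U)) Φ.comm₁₂) s
  refine ⟨fun e => AbSheaf.app Φ.τ₂ _ (s e), fun i j => AbSheaf.app Φ.τ₃ _ (q i j),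
    Sheaf.H.map Φ.τ₃ 1 κ, fun e e' e'' => ?_, fun e => ?_, h₃.map Φ.τ₃, ?_⟩
  · rw [ef, h₁, map_sub, map_add, AbSheaf.app_res, AbSheaf.app_res, AbSheaf.app_res]
  · rw [eg, h₂, AbSheaf.app_res]
  · rw [connecting_naturality hS hS']

lemma RepresentsH2In.sub {S : ShortComplex (AbSheaf X)} {hS : S.ShortExact}
    {a a' : ∀ {i j k} (e : 𝓤.E i j) (e' : 𝓤.E j k) (e'' : 𝓤.E i k), S.X₁.sec (𝓤.W e e' e'')}
    {η η' : Sheaf.H S.X₁ 2} (h : RepresentsH2In hS a η) (h' : RepresentsH2In hS a' η') :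
    RepresentsH2In hS (fun e e' e'' => a e e' e'' - a' e e' e'') (η - η') := by
  obtain ⟨s, q, κ, h₁, h₂, h₃, rfl⟩ := h
  obtain ⟨s', q', κ', h₁', h₂', h₃', rfl⟩ := h'
  refine ⟨fun e => s e - s' e, fun i j => q i j - q' i j, κ - κ', fun e e' e'' => ?_,
    fun e => ?_, h₃.sub h₃', ?_⟩
  · rw [map_sub, map_sub, map_sub, map_sub, h₁, h₁']
    abel
  · rw [map_sub, map_sub, h₂, h₂']
  · rw [connecting_sub]

lemma RepresentsH2.inInjective {F : AbSheaf X}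
    {a : ∀ {i j k} (e : 𝓤.E i j) (e' : 𝓤.E j k) (e'' : 𝓤.E i k), F.sec (𝓤.W e e' e'')}
    {η : Sheaf.H F 2} (h : RepresentsH2 F a η) :
    RepresentsH2In (injectiveComplex_shortExact F) a η := by
  obtain ⟨I, Q, f, g, w, hS, h⟩ := h
  obtain ⟨Φ, hΦ⟩ := exists_hom_of_injective (S' := injectiveComplex F) hS (𝟙 F)
  have e := RepresentsH2In.map (S := ShortComplex.mk f g w) (hS := hS) h
    (injectiveComplex_shortExact F) Φ
  rw [hΦ] at e
  simpa only [Sheaf.H.map_id_apply] using! e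

lemma RepresentsH2.sub {F : AbSheaf X}
    {a a' : ∀ {i j k} (e : 𝓤.E i j) (e' : 𝓤.E j k) (e'' : 𝓤.E i k), F.sec (𝓤.W e e' e'')}
    {η η' : Sheaf.H F 2} (h : RepresentsH2 F a η) (h' : RepresentsH2 F a' η') :
    RepresentsH2 F (fun e e' e'' => a e e' e'' - a' e e' e'') (η - η') :=
  (h.inInjective.sub h'.inInjective).representsH2

lemma RepresentsH2.refine {F : AbSheaf X}
    {a : ∀ {i j k} (e : 𝓤.E i j) (e' : 𝓤.E j k) (e'' : 𝓤.E i k), F.sec (𝓤.W e e' e'')}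
    {η : Sheaf.H F 2} (h : RepresentsH2 F a η) {𝓥 : HyperCover X} (ρ : 𝓥.Refinement 𝓤) :
    RepresentsH2 F (𝓤 := 𝓥) (fun e e' e'' => F.res (ρ.W_le e e' e'')
      (a (ρ.edge e) (ρ.edge e') (ρ.edge e''))) η := by
  obtain ⟨I, Q, f, g, w, hS, s, q, κ, h₁, h₂, h₃, rfl⟩ := h
  refine ⟨I, Q, f, g, w, hS, fun e => I.res (ρ.V_le e) (s (ρ.edge e)), _, κ,
    fun e e' e'' => ?_, fun e => ?_, h₃.refine ρ.refines, rfl⟩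
  · rw [AbSheaf.app_res, h₁, map_sub, map_add]
    simp only [AbSheaf.res_res]
  · rw [AbSheaf.app_res, h₂, AbSheaf.res_res, AbSheaf.res_res]

lemma HyperCover.exists_glue (F : AbSheaf X) (z : ∀ {i j} (e : 𝓤.E i j), F.sec (𝓤.V e))
    (hz : ∀ {i j k} (e : 𝓤.E i j) (e' : 𝓤.E j k) (e'' : 𝓤.E i k) (T : Opens X)
      (h : T ≤ 𝓤.V e) (h' : T ≤ 𝓤.V e') (h'' : T ≤ 𝓤.V e''),
      F.res h (z e) + F.res h' (z e') = F.res h'' (z e'')) :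
    ∃ q : ∀ i j, F.sec (𝓤.U i ⊓ 𝓤.U j),
      (∀ {i j} (e : 𝓤.E i j), z e = F.res (𝓤.V_le e) (q i j)) ∧
      (∀ i j k (T : Opens X) (hij : T ≤ 𝓤.U i ⊓ 𝓤.U j) (hjk : T ≤ 𝓤.U j ⊓ 𝓤.U k)
        (hik : T ≤ 𝓤.U i ⊓ 𝓤.U k), F.res hij (q i j) + F.res hjk (q j k) = F.res hik (q i k)) := by
  have glue : ∀ i j, ∃ q : F.sec (𝓤.U i ⊓ 𝓤.U j), ∀ e : 𝓤.E i j, F.res (𝓤.V_le e) q = z e := by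
    intro i j
    refine AbSheaf.glue F (fun e : 𝓤.E i j => 𝓤.V e) (fun e => 𝓤.V_le e) (𝓤.iSup_V i j).ge
      (fun e => z e) fun e e₁ => AbSheaf.sec_ext F fun x hx => ?_
    have hxj : x ∈ 𝓤.U j := (𝓤.V_le e hx.1).2
    obtain ⟨e', he'⟩ := 𝓤.exists_mem hxj hxj
    refine ⟨𝓤.V e ⊓ 𝓤.V e₁ ⊓ 𝓤.V e', inf_le_left, ⟨hx, he'⟩, ?_⟩
    rw [AbSheaf.res_res, AbSheaf.res_res]
    have f₁ := hz e e' e₁ (𝓤.V e ⊓ 𝓤.V e₁ ⊓ 𝓤.V e') (inf_le_left.trans inf_le_left) inf_le_right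
      (inf_le_left.trans inf_le_right)
    have f₂ := hz e e' e (𝓤.V e ⊓ 𝓤.V e₁ ⊓ 𝓤.V e') (inf_le_left.trans inf_le_left) inf_le_right
      (inf_le_left.trans inf_le_left)
    exact f₂.symm.trans f₁
  choose q hq using glue
  refine ⟨q, fun e => (hq _ _ e).symm, fun i j k T hij hjk hik => AbSheaf.sec_ext F fun x hx => ?_⟩
  obtain ⟨e, he⟩ := 𝓤.exists_mem (hij hx).1 (hij hx).2
  obtain ⟨e', he'⟩ := 𝓤.exists_mem (hjk hx).1 (hjk hx).2
  obtain ⟨e'', he''⟩ := 𝓤.exists_mem (hik hx).1 (hik hx).2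
  have h₀ : T ⊓ 𝓤.W e e' e'' ≤ 𝓤.W e e' e'' := inf_le_right
  refine ⟨T ⊓ 𝓤.W e e' e'', inf_le_left, ⟨hx, ⟨he, he'⟩, he''⟩, ?_⟩
  have := hz e e' e'' (T ⊓ 𝓤.W e e' e'') (h₀.trans (W_le₁ _ _ _)) (h₀.trans (W_le₂ _ _ _))
    (h₀.trans (W_le₃ _ _ _))
  rw [← hq, ← hq, ← hq, AbSheaf.res_res, AbSheaf.res_res, AbSheaf.res_res] at this
  rw [map_add, AbSheaf.res_res, AbSheaf.res_res, AbSheaf.res_res]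
  exact this

lemma RepresentsH2.eq_zero {F : AbSheaf X}
    {a : ∀ {i j k} (e : 𝓤.E i j) (e' : 𝓤.E j k) (e'' : 𝓤.E i k), F.sec (𝓤.W e e' e'')}
    {η : Sheaf.H F 2} (h : RepresentsH2 F a η) (α : ∀ {i j} (e : 𝓤.E i j), F.sec (𝓤.V e))
    (hα : ∀ {i j k} (e : 𝓤.E i j) (e' : 𝓤.E j k) (e'' : 𝓤.E i k),
      a e e' e'' = F.res (HyperCover.W_le₁ e e' e'') (α e) +
        F.res (HyperCover.W_le₂ e e' e'') (α e') - F.res (HyperCover.W_le₃ e e' e'') (α e'')) :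
    η = 0 := by
  obtain ⟨I, Q, f, g, w, hS, s, q, κ, h₁, h₂, h₃, rfl⟩ := h
  have hgf : ∀ U s, AbSheaf.app g U (AbSheaf.app f U s) = 0 := fun U s =>
    ConcreteCategory.congr_hom (congrArg (fun φ => φ.hom.app (op U)) w) s
  obtain ⟨z, hz, hz'⟩ := HyperCover.exists_glue (𝓤 := 𝓤) I (fun e => s e - AbSheaf.app f _ (α e))
    (fun e e' e'' T h h' h'' => by
      have hT : T ≤ 𝓤.W e e' e'' := le_inf (le_inf h h') h''
      have := h₁ e e' e''
      beta_reduce at this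
      rw [hα, map_sub, map_add, AbSheaf.app_res, AbSheaf.app_res, AbSheaf.app_res] at this
      have := congrArg (I.res hT) this
      simp only [map_sub, map_add, AbSheaf.res_res] at this ⊢
      rw [← sub_eq_zero] at this ⊢
      rw [← neg_eq_zero, ← this]
      abel)
  obtain ⟨ζ, hζ⟩ := exists_representsH1 (𝓤 := 𝓤.toOpenCover) z hz'
  have hqz : q = fun i j => AbSheaf.app g _ (z i j) := by
    funext i j
    refine AbSheaf.sec_ext Q fun x hx => ?_
    obtain ⟨e, he⟩ := 𝓤.exists_mem hx.1 hx.2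
    refine ⟨𝓤.V e, 𝓤.V_le e, he, ?_⟩
    rw [← h₂, ← AbSheaf.app_res, ← hz, map_sub, hgf, sub_zero]
  rw [hqz] at h₃
  rw [h₃.unique (hζ.map g)]
  exact connecting_map_g hS ζ

lemma exists_representsH2 {F : AbSheaf X}
    (a : ∀ {i j k} (e : 𝓤.E i j) (e' : 𝓤.E j k) (e'' : 𝓤.E i k), F.sec (𝓤.W e e' e''))
    (ha : ∀ {i j k l} (e : 𝓤.E i j) (e' : 𝓤.E j k) (e'' : 𝓤.E i k) (d : 𝓤.E i l) (d' : 𝓤.E j l)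
      (d'' : 𝓤.E k l) (T : Opens X) (h : T ≤ 𝓤.W e e' e'') (h₀ : T ≤ 𝓤.W e d' d)
      (h₁ : T ≤ 𝓤.W e' d'' d') (h₂ : T ≤ 𝓤.W e'' d'' d),
      F.res h (a e e' e'') + F.res h₂ (a e'' d'' d) =
        F.res h₀ (a e d' d) + F.res h₁ (a e' d'' d')) :
    ∃ η, RepresentsH2 F a η := by
  have hS := cokernelComplex_shortExact (toGodement F)
  choose r hr using fun x : X => Opens.mem_iSup.1 (𝓤.isOpenCover.ge (Opens.mem_top x))
  choose ε hε using fun (x : X) (i : 𝓤.ι) (hi : x ∈ 𝓤.U i) => 𝓤.exists_mem hi (hr x)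
  have hW : ∀ {i j} (e : 𝓤.E i j) (x : 𝓤.V e),
      x.1 ∈ 𝓤.W e (ε x j (𝓤.V_le e x.2).2) (ε x i (𝓤.V_le e x.2).1) :=
    fun e x => ⟨⟨x.2, hε _ _ _⟩, hε _ _ _⟩
  let s : ∀ {i j} (e : 𝓤.E i j), (godement F).sec (𝓤.V e) := fun e =>
    godementMk F _ fun x => F.germ (hW e x) (a e (ε x _ (𝓤.V_le e x.2).2) (ε x _ (𝓤.V_le e x.2).1))
  have hs : ∀ {i j k} (e : 𝓤.E i j) (e' : 𝓤.E j k) (e'' : 𝓤.E i k),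
      AbSheaf.app (toGodement F) _ (a e e' e'') =
        (godement F).res (HyperCover.W_le₁ e e' e'') (s e) +
          (godement F).res (HyperCover.W_le₂ e e' e'') (s e') -
          (godement F).res (HyperCover.W_le₃ e e' e'') (s e'') := by
    intro i j k e e' e''
    refine funext fun (x : 𝓤.W e e' e'') => ?_
    have h₁ := hW e ⟨x.1, HyperCover.W_le₁ e e' e'' x.2⟩
    have h₂ := hW e' ⟨x.1, HyperCover.W_le₂ e e' e'' x.2⟩
    have h₃ := hW e'' ⟨x.1, HyperCover.W_le₃ e e' e'' x.2⟩
    have hT : x.1 ∈ 𝓤.W e e' e'' ⊓ 𝓤.W e _ _ ⊓ 𝓤.W e' _ _ ⊓ 𝓤.W e'' _ _ :=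
      ⟨⟨⟨x.2, h₁⟩, h₂⟩, h₃⟩
    have := congrArg (F.germ hT) (ha e e' e'' _ _ _ _ (inf_le_left.trans <| inf_le_left.trans
      inf_le_left) (inf_le_left.trans <| inf_le_left.trans inf_le_right)
      (inf_le_left.trans inf_le_right) inf_le_right)
    rw [map_add, map_add, AbSheaf.germ_res, AbSheaf.germ_res, AbSheaf.germ_res,
      AbSheaf.germ_res] at this
    exact eq_sub_of_add_eq this
  have hgf : ∀ U s, AbSheaf.app (cokernelComplex (toGodement F)).g U
      (AbSheaf.app (toGodement F) U s) = 0 := fun U s =>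
    ConcreteCategory.congr_hom (congrArg (fun φ => φ.hom.app (op U))
      (cokernelComplex (toGodement F)).zero) s
  obtain ⟨q, hq, hq'⟩ := HyperCover.exists_glue (𝓤 := 𝓤) (cokernelComplex (toGodement F)).X₃
    (fun e => AbSheaf.app (cokernelComplex (toGodement F)).g _ (s e))
    (fun e e' e'' T h h' h'' => by
      have hT : T ≤ 𝓤.W e e' e'' := le_inf (le_inf h h') h''
      have := hgf _ (a e e' e'')
      rw [hs, map_sub, map_add, AbSheaf.app_res, AbSheaf.app_res, AbSheaf.app_res,
        sub_eq_zero] at this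
      have := congrArg (AbSheaf.res _ hT) this
      rw [map_add, AbSheaf.res_res, AbSheaf.res_res, AbSheaf.res_res] at this
      exact this)
  obtain ⟨κ, hκ⟩ := exists_representsH1 (𝓤 := 𝓤.toOpenCover) q hq'
  exact ⟨_, _, _, _, _, _, hS, s, q, κ, hs, hq, hκ, rfl⟩
end

/-! ### Commutative sheaves of groups in additive notation -/

/-- A section of a commutative sheaf of groups, in additive notation. -/
abbrev GrpSheaf.toAdd {A : GrpSheaf X} (hA : A.IsComm) {U : Opens X} (a : A.sec U) :
    (A.toAb hA).sec U :=
  A.toAbSec hA U (Additive.ofMul a)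

namespace GrpSheaf
variable {A : GrpSheaf X} (hA : A.IsComm) {U V : Opens X}

lemma toAdd_injective : Function.Injective (GrpSheaf.toAdd hA (U := U)) := fun _ _ h => h

lemma toAdd_mul (a b : A.sec U) : toAdd hA (a * b) = toAdd hA a + toAdd hA b := rfl

lemma toAdd_one : toAdd hA (1 : A.sec U) = 0 := rfl

lemma res_toAdd (h : V ≤ U) (a : A.sec U) :
    (A.toAb hA).res h (toAdd hA a) = toAdd hA (A.res h a) := rfl
end GrpSheaf

/-! ### Nonabelian cocycles -/

lemma Cocycle.ext_ev {G : GrpSheaf X} {𝓤 : OpenCover X} {γ γ' : Cocycle G 𝓤}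
    (h : ∀ i j (T : Opens X) (a : T ⟶ 𝓤.U i) (b : T ⟶ 𝓤.U j), γ.ev i j a b = γ'.ev i j a b) :
    γ = γ' := by
  obtain ⟨γ, _⟩ := γ
  obtain ⟨γ', _⟩ := γ'
  congr
  ext i j T a b
  exact h i j T a b

lemma Cocycle.ev_eq {G : GrpSheaf X} {𝓤 : OpenCover X} (γ : Cocycle G 𝓤) (i j : 𝓤.ι)
    {T : Opens X} (a : T ⟶ 𝓤.U i) (b : T ⟶ 𝓤.U j) :
    γ.ev i j a b = G.res (le_inf (leOfHom a) (leOfHom b)) (Cocycle.val γ i j) :=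
  (γ.ev_precomp i j (homOfLE (le_inf (leOfHom a) (leOfHom b))) (homOfLE inf_le_left)
    (homOfLE inf_le_right)).symm

lemma Cocycle.res_mul_res {G : GrpSheaf X} {𝓤 : OpenCover X} (γ : Cocycle G 𝓤) (i j k : 𝓤.ι)
    (T : Opens X) (hij : T ≤ 𝓤.U i ⊓ 𝓤.U j) (hjk : T ≤ 𝓤.U j ⊓ 𝓤.U k) (hik : T ≤ 𝓤.U i ⊓ 𝓤.U k) :
    G.res hij (Cocycle.val γ i j) * G.res hjk (Cocycle.val γ j k) =
      G.res hik (Cocycle.val γ i k) := by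
  have := γ.ev_trans i j k (homOfLE (hij.trans inf_le_left)) (homOfLE (hij.trans inf_le_right))
    (homOfLE (hik.trans inf_le_right))
  rwa [Cocycle.ev_eq, Cocycle.ev_eq, Cocycle.ev_eq] at this

/-- A cocycle given by its values on the intersections `U_i ∩ U_j`. -/
def Cocycle.ofVal {G : GrpSheaf X} {𝓤 : OpenCover X} (g : ∀ i j, G.sec (𝓤.U i ⊓ 𝓤.U j))
    (hg : ∀ i j k (T : Opens X) (hij : T ≤ 𝓤.U i ⊓ 𝓤.U j) (hjk : T ≤ 𝓤.U j ⊓ 𝓤.U k)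
      (hik : T ≤ 𝓤.U i ⊓ 𝓤.U k), G.res hij (g i j) * G.res hjk (g j k) = G.res hik (g i k)) :
    Cocycle G 𝓤 where
  ev i j _ a b := G.res (le_inf (leOfHom a) (leOfHom b)) (g i j)
  ev_precomp _ _ _ _ _ _ _ := GrpSheaf.res_res _ _ _ _
  ev_trans i j k _ _ _ _ := hg i j k _ _ _ _

lemma Cocycle.ofVal_val {G : GrpSheaf X} {𝓤 : OpenCover X} (g : ∀ i j, G.sec (𝓤.U i ⊓ 𝓤.U j))
    (hg) (i j : 𝓤.ι) : (Cocycle.ofVal g hg).val i j = g i j :=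
  GrpSheaf.res_self _ _ _

lemma Cocycle.refine_val {G : GrpSheaf X} {𝓤 𝓥 : OpenCover X} (γ : Cocycle G 𝓤) {ρ : 𝓥.ι → 𝓤.ι}
    (h : 𝓥.Refines 𝓤 ρ) (i j : 𝓥.ι) :
    (γ.refine h).val i j = G.res (inf_le_inf (h i) (h j)) (Cocycle.val γ (ρ i) (ρ j)) :=
  Cocycle.ev_eq γ _ _ _ _

lemma Cocycle.map_val {G G' : GrpSheaf X} {𝓤 : OpenCover X} (f : G ⟶ G') (γ : Cocycle G 𝓤)
    (i j : 𝓤.ι) : (Cocycle.map f γ).val i j = GrpSheaf.app f _ (Cocycle.val γ i j) := rfl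

lemma Cocycle.isCohomologous_of_val {G : GrpSheaf X} {𝓤 : OpenCover X} {γ γ' : Cocycle G 𝓤}
    (α : ∀ i, G.sec (𝓤.U i))
    (h : ∀ i j, G.res inf_le_left (α i) * γ.val i j = γ'.val i j * G.res inf_le_right (α j)) :
    γ.IsCohomologous γ' := by
  refine ⟨α, fun i j T a b => ?_⟩
  have := congrArg (G.res (le_inf (leOfHom a) (leOfHom b))) (h i j)
  rw [map_mul, map_mul, GrpSheaf.res_res, GrpSheaf.res_res, ← Cocycle.ev_eq,
    ← Cocycle.ev_eq] at this
  exact this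

lemma Cocycle.equivalent_of_val {G : GrpSheaf X} {𝓤 𝓤' 𝓦 : OpenCover X} {γ : Cocycle G 𝓤}
    {γ' : Cocycle G 𝓤'} {ρ : 𝓦.ι → 𝓤.ι} {σ : 𝓦.ι → 𝓤'.ι} (hρ : 𝓦.Refines 𝓤 ρ)
    (hσ : 𝓦.Refines 𝓤' σ) (α : ∀ i, G.sec (𝓦.U i))
    (h : ∀ i j, G.res inf_le_left (α i) *
        G.res (inf_le_inf (hρ i) (hρ j)) (Cocycle.val γ (ρ i) (ρ j)) =
      G.res (inf_le_inf (hσ i) (hσ j)) (Cocycle.val γ' (σ i) (σ j)) * G.res inf_le_right (α j)) :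
    Cocycle.Equivalent ⟨𝓤, γ⟩ ⟨𝓤', γ'⟩ :=
  ⟨𝓦, ρ, σ, hρ, hσ, Cocycle.isCohomologous_of_val α fun i j => by
    rw [Cocycle.refine_val, Cocycle.refine_val]
    exact h i j⟩

/-- The covering by the intersections of the members of two coverings. -/
abbrev OpenCover.inf (𝓤 𝓥 : OpenCover X) : OpenCover X where
  ι := 𝓤.ι × 𝓥.ι
  U i := 𝓤.U i.1 ⊓ 𝓥.U i.2
  isOpenCover := top_le_iff.1 fun x _ => by
    obtain ⟨i, hi⟩ := Opens.mem_iSup.1 (𝓤.isOpenCover.ge (Opens.mem_top x))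
    obtain ⟨j, hj⟩ := Opens.mem_iSup.1 (𝓥.isOpenCover.ge (Opens.mem_top x))
    exact Opens.mem_iSup.2 ⟨(i, j), hi, hj⟩

lemma OpenCover.inf_refines_left (𝓤 𝓥 : OpenCover X) : (𝓤.inf 𝓥).Refines 𝓤 Prod.fst :=
  fun _ => inf_le_left

lemma OpenCover.inf_refines_right (𝓤 𝓥 : OpenCover X) : (𝓤.inf 𝓥).Refines 𝓥 Prod.snd :=
  fun _ => inf_le_right

lemma Cocycle.Equivalent.map {G G' : GrpSheaf X} (f : G ⟶ G') {𝓤 𝓤' : OpenCover X}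
    {γ : Cocycle G 𝓤} {γ' : Cocycle G 𝓤'} (h : Cocycle.Equivalent ⟨𝓤, γ⟩ ⟨𝓤', γ'⟩) :
    Cocycle.Equivalent ⟨𝓤, Cocycle.map f γ⟩ ⟨𝓤', Cocycle.map f γ'⟩ := by
  obtain ⟨𝓦, ρ, σ, hρ, hσ, α, hα⟩ := h
  refine ⟨𝓦, ρ, σ, hρ, hσ, fun i => GrpSheaf.app f _ (α i), fun i j T a b => ?_⟩
  have := congrArg (GrpSheaf.app f T) (hα i j a b)
  rw [map_mul, map_mul] at this
  have ea := GrpSheaf.app_res f (leOfHom a) (α i)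
  have eb := GrpSheaf.app_res f (leOfHom b) (α j)
  exact ((congrArg (· * _) ea).symm.trans this).trans (congrArg (_ * ·) eb)

/-! ### Cocycles with values in a commutative sheaf of groups -/

section
variable {A : GrpSheaf X} {hA : A.IsComm} {𝓤 𝓤' : OpenCover X}

lemma IsClassOf.refine {γ : Cocycle A 𝓤} {η : Sheaf.H (A.toAb hA) 1} (h : IsClassOf hA γ η)
    {ρ : 𝓤'.ι → 𝓤.ι} (hρ : 𝓤'.Refines 𝓤 ρ) : IsClassOf hA (γ.refine hρ) η := by
  have := RepresentsH1.refine h hρ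
  unfold IsClassOf
  simp only [Cocycle.refine_val]
  exact this

lemma IsClassOf.eq_iff_isCohomologous {γ γ' : Cocycle A 𝓤} {η η' : Sheaf.H (A.toAb hA) 1}
    (h : IsClassOf hA γ η) (h' : IsClassOf hA γ' η') : η = η' ↔ γ.IsCohomologous γ' := by
  have key := (RepresentsH1.sub h' h).eq_zero_iff
  rw [eq_comm, ← sub_eq_zero, key]
  constructor
  · rintro ⟨y, hy⟩
    refine Cocycle.isCohomologous_of_val y fun i j => GrpSheaf.toAdd_injective hA ?_
    exact (sub_eq_sub_iff_add_eq_add.1 (hy i j)).symm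
  · rintro ⟨α, hα⟩
    refine ⟨fun i => GrpSheaf.toAdd hA (α i), fun i j => ?_⟩
    have := congrArg (GrpSheaf.toAdd hA) (hα i j (homOfLE inf_le_left) (homOfLE inf_le_right))
    rw [GrpSheaf.toAdd_mul, GrpSheaf.toAdd_mul] at this
    rw [sub_eq_sub_iff_add_eq_add]
    exact this.symm

lemma IsClassOf.eq_of_equivalent {γ : Cocycle A 𝓤} {γ' : Cocycle A 𝓤'}
    {η η' : Sheaf.H (A.toAb hA) 1} (h : IsClassOf hA γ η) (h' : IsClassOf hA γ' η')
    (e : Cocycle.Equivalent ⟨𝓤, γ⟩ ⟨𝓤', γ'⟩) : η = η' := by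
  obtain ⟨𝓦, ρ, σ, hρ, hσ, e⟩ := e
  exact ((h.refine hρ).eq_iff_isCohomologous (h'.refine hσ)).2 e

lemma IsClassOf.equivalent {γ : Cocycle A 𝓤} {γ' : Cocycle A 𝓤'}
    {η : Sheaf.H (A.toAb hA) 1} (h : IsClassOf hA γ η) (h' : IsClassOf hA γ' η) :
    Cocycle.Equivalent ⟨𝓤, γ⟩ ⟨𝓤', γ'⟩ :=
  ⟨𝓤.inf 𝓤', _, _, 𝓤.inf_refines_left 𝓤', 𝓤.inf_refines_right 𝓤',
    ((h.refine _).eq_iff_isCohomologous (h'.refine _)).1 rfl⟩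

lemma Cocycle.exists_isClassOf (hA : A.IsComm) (γ : Cocycle A 𝓤) : ∃ η, IsClassOf hA γ η :=
  exists_representsH1 _ fun i j k T hij hjk hik =>
    congrArg (GrpSheaf.toAdd hA) (γ.res_mul_res i j k T hij hjk hik)

lemma exists_isClassOf (η : Sheaf.H (A.toAb hA) 1) :
    ∃ (𝓤 : OpenCover X) (γ : Cocycle A 𝓤), IsClassOf hA γ η := by
  obtain ⟨𝓤, a, ha, h⟩ := exists_cocycle_representsH1 η
  obtain ⟨g, rfl⟩ : ∃ g : ∀ i j, A.sec (𝓤.U i ⊓ 𝓤.U j),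
      (fun i j => GrpSheaf.toAdd hA (g i j)) = a :=
    ⟨a, rfl⟩
  have hg : ∀ i j k (T : Opens X) (hij : T ≤ 𝓤.U i ⊓ 𝓤.U j) (hjk : T ≤ 𝓤.U j ⊓ 𝓤.U k)
      (hik : T ≤ 𝓤.U i ⊓ 𝓤.U k), A.res hij (g i j) * A.res hjk (g j k) = A.res hik (g i k) := ha
  refine ⟨𝓤, Cocycle.ofVal g hg, ?_⟩
  unfold IsClassOf
  simp only [Cocycle.ofVal_val]
  exact h

lemma exists_isMapH1 {B : GrpSheaf X} (hA : A.IsComm) (f : A ⟶ B) : ∃ φ, IsMapH1 hA f φ := by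
  choose 𝓤 γ h using fun η : Sheaf.H (A.toAb hA) 1 => exists_isClassOf η
  refine ⟨fun η => (Cocycle.map f (γ η)).cls, fun η ξ => ⟨?_, ?_⟩⟩
  · rintro rfl
    exact ⟨_, _, h η, rfl⟩
  · rintro ⟨𝓤', γ', h', rfl⟩
    exact Quot.sound (((h η).equivalent h').map f)
end

section
variable {G : Type*} [Group G]

lemma mul_inv_mul_mul_inv_of_commute {x y z u v w : G}
    (h : y * w * v⁻¹ * (v * u⁻¹) = v * u⁻¹ * (y * w * v⁻¹)) :
    x * y * z⁻¹ * (z * w * u⁻¹) = x * v * u⁻¹ * (y * w * v⁻¹) :=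
  calc x * y * z⁻¹ * (z * w * u⁻¹) = x * (y * w * v⁻¹ * (v * u⁻¹)) := by group
    _ = x * v * u⁻¹ * (y * w * v⁻¹) := by rw [h]; group

lemma mul_inv_mul_conj_of_commute {b₁ b₂ b₃ c₁ c₂ c₃ l₁ l₂ l₃ : G}
    (h : c₂ * l₃ * b₂⁻¹ * l₂⁻¹ * (l₁ * b₁ * l₂⁻¹) = l₁ * b₁ * l₂⁻¹ * (c₂ * l₃ * b₂⁻¹ * l₂⁻¹))
    (h' : b₁ * b₂ * b₃⁻¹ * l₁ = l₁ * (b₁ * b₂ * b₃⁻¹)) :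
    c₁ * c₂ * c₃⁻¹ * (c₃ * l₃ * b₃⁻¹ * l₁⁻¹) =
      c₁ * l₂ * b₁⁻¹ * l₁⁻¹ * (c₂ * l₃ * b₂⁻¹ * l₂⁻¹) * (b₁ * b₂ * b₃⁻¹) :=
  calc c₁ * c₂ * c₃⁻¹ * (c₃ * l₃ * b₃⁻¹ * l₁⁻¹) = c₁ * l₂ * b₁⁻¹ * l₁⁻¹ *
        (l₁ * b₁ * l₂⁻¹ * (c₂ * l₃ * b₂⁻¹ * l₂⁻¹)) * (l₂ * b₂ * b₃⁻¹ * l₁⁻¹) := by group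
    _ = c₁ * l₂ * b₁⁻¹ * l₁⁻¹ * (c₂ * l₃ * b₂⁻¹ * l₂⁻¹) *
        (l₁ * (b₁ * b₂ * b₃⁻¹) * l₁⁻¹) := by rw [← h]; group
    _ = _ := by rw [← h', mul_inv_cancel_right]
end

/-! ### The connecting maps of an extension of sheaves of groups -/

/-- `1 ⟶ A ⟶ B ⟶ C ⟶ 1` is an extension of sheaves of groups. -/
structure IsExtension {A B C : GrpSheaf X} (i : A ⟶ B) (p : B ⟶ C) : Prop where
  injective : ∀ U, Function.Injective (GrpSheaf.app i U)
  app_app : ∀ U a, GrpSheaf.app p U (GrpSheaf.app i U a) = 1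
  exact : ∀ U b, GrpSheaf.app p U b = 1 → ∃ a, GrpSheaf.app i U a = b
  exists_lift : ∀ (U : Opens X) (c : C.sec U), ∀ x ∈ U, ∃ (V : Opens X) (h : V ≤ U) (b : B.sec V),
    x ∈ V ∧ GrpSheaf.app p V b = C.res h c

section
variable {A B C : GrpSheaf X} {hA : A.IsComm} {i : A ⟶ B} {p : B ⟶ C}

/-- `η` is the class of the cocycle `b_r b_s⁻¹` defined by local lifts `b_r` of the section `c`. -/
def IsConnectingValue₁ (hA : A.IsComm) (i : A ⟶ B) (p : B ⟶ C) (c : C.sec ⊤)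
    (η : Sheaf.H (A.toAb hA) 1) : Prop :=
  ∃ (𝓤 : OpenCover X) (b : ∀ r, B.sec (𝓤.U r)) (γ : Cocycle A 𝓤),
    (∀ r, GrpSheaf.app p (𝓤.U r) (b r) = C.res le_top c) ∧
    (∀ r s, GrpSheaf.app i (𝓤.U r ⊓ 𝓤.U s) (γ.val r s) =
      B.res inf_le_left (b r) * (B.res inf_le_right (b s))⁻¹) ∧
    IsClassOf hA γ η

lemma IsExtension.exists_cocycle (H : IsExtension i p) (c : C.sec ⊤) {𝓤 : OpenCover X}
    (b : ∀ r, B.sec (𝓤.U r)) (hb : ∀ r, GrpSheaf.app p (𝓤.U r) (b r) = C.res le_top c) :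
    ∃ γ : Cocycle A 𝓤, ∀ r s, GrpSheaf.app i (𝓤.U r ⊓ 𝓤.U s) (γ.val r s) =
      B.res inf_le_left (b r) * (B.res inf_le_right (b s))⁻¹ := by
  have : ∀ r s, ∃ a, GrpSheaf.app i (𝓤.U r ⊓ 𝓤.U s) a =
      B.res inf_le_left (b r) * (B.res inf_le_right (b s))⁻¹ := fun r s => H.exact _ _ (by
    rw [map_mul, map_inv, GrpSheaf.app_res, GrpSheaf.app_res, hb, hb, GrpSheaf.res_res,
      GrpSheaf.res_res, mul_inv_cancel])
  choose a ha using this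
  refine ⟨Cocycle.ofVal a fun r s t T hrs hst hrt => H.injective _ ?_, fun r s => ?_⟩
  · simp only [map_mul, GrpSheaf.app_res, ha, map_inv, GrpSheaf.res_res]
    group
  · rw [Cocycle.ofVal_val, ha]

lemma IsExtension.exists_isConnectingValue₁ (hA : A.IsComm) (H : IsExtension i p) (c : C.sec ⊤) :
    ∃ η, IsConnectingValue₁ hA i p c η := by
  choose V hV b hx hb using fun x : X => H.exists_lift ⊤ c x (Opens.mem_top x)
  let 𝓤 : OpenCover X := ⟨X, V, top_le_iff.1 fun x _ => Opens.mem_iSup.2 ⟨x, hx x⟩⟩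
  obtain ⟨γ, hγ⟩ := H.exists_cocycle (𝓤 := 𝓤) c b hb
  obtain ⟨η, hη⟩ := Cocycle.exists_isClassOf hA γ
  exact ⟨η, 𝓤, b, γ, hb, hγ, hη⟩

lemma IsConnectingValue₁.unique (H : IsExtension i p) {c : C.sec ⊤}
    {η η' : Sheaf.H (A.toAb hA) 1} (h : IsConnectingValue₁ hA i p c η)
    (h' : IsConnectingValue₁ hA i p c η') : η = η' := by
  obtain ⟨𝓤, b, γ, h₁, h₂, h₃⟩ := h
  obtain ⟨𝓤', b', γ', h₁', h₂', h₃'⟩ := h'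
  have : ∀ w : 𝓤.ι × 𝓤'.ι, ∃ a, GrpSheaf.app i (𝓤.U w.1 ⊓ 𝓤'.U w.2) a =
      B.res inf_le_right (b' w.2) * (B.res inf_le_left (b w.1))⁻¹ := fun w => H.exact _ _ (by
    rw [map_mul, map_inv, GrpSheaf.app_res, GrpSheaf.app_res, h₁, h₁', GrpSheaf.res_res,
      GrpSheaf.res_res, mul_inv_cancel])
  choose α hα using this
  refine h₃.eq_of_equivalent h₃' (Cocycle.equivalent_of_val (𝓤.inf_refines_left 𝓤')
    (𝓤.inf_refines_right 𝓤') α fun v w => H.injective _ ?_)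
  simp only [map_mul, GrpSheaf.app_res, hα, h₂, h₂', map_inv, GrpSheaf.res_res]
  group

lemma IsExtension.exists_isConnecting₁ (hA : A.IsComm) (H : IsExtension i p) :
    ∃ δ, IsConnecting₁ hA i p δ := by
  choose δ hδ using H.exists_isConnectingValue₁ hA
  exact ⟨δ, fun c η => ⟨fun e => e ▸ hδ c, fun h => (hδ c).unique H h⟩⟩

/-- `η` is the class of the cocycle `b_{rs} b_{st} b_{rt}⁻¹` defined by local lifts `b_{rs}` of the
cocycle `c_{rs}`. -/
def IsConnectingValue₂ (hA : A.IsComm) (i : A ⟶ B) (p : B ⟶ C) (𝓤 : HyperCover X)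
    (c : Cocycle C 𝓤.toOpenCover) (η : Sheaf.H (A.toAb hA) 2) : Prop :=
  ∃ (b : ∀ {r s} (e : 𝓤.E r s), B.sec (𝓤.V e))
    (a : ∀ {r s t} (e : 𝓤.E r s) (e' : 𝓤.E s t) (e'' : 𝓤.E r t), A.sec (𝓤.W e e' e'')),
    (∀ {r s} (e : 𝓤.E r s),
      GrpSheaf.app p (𝓤.V e) (b e) = C.res (𝓤.V_le e) (Cocycle.val c r s)) ∧
    (∀ {r s t} (e : 𝓤.E r s) (e' : 𝓤.E s t) (e'' : 𝓤.E r t),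
      GrpSheaf.app i _ (a e e' e'') =
        B.res (HyperCover.W_le₁ e e' e'') (b e) * B.res (HyperCover.W_le₂ e e' e'') (b e') *
          (B.res (HyperCover.W_le₃ e e' e'') (b e''))⁻¹) ∧
    RepresentsH2 (A.toAb hA) (fun e e' e'' => GrpSheaf.toAdd hA (a e e' e'')) η

lemma IsExtension.exists_isConnectingValue₂ (hA : A.IsComm) (H : IsExtension i p)
    (hc : ∀ U a b, GrpSheaf.app i U a * b = b * GrpSheaf.app i U a) {𝓤 : OpenCover X}
    (c : Cocycle C 𝓤) :
    ∃ (E : 𝓤.ι → 𝓤.ι → Type u) (V : ∀ {r s}, E r s → Opens X)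
      (hV : ∀ r s, ⨆ e : E r s, V e = 𝓤.U r ⊓ 𝓤.U s) (η : _),
      IsConnectingValue₂ hA i p ⟨𝓤, E, V, hV⟩ c η := by
  choose V hV b hx hb using fun (r s : 𝓤.ι) (x : ↥(𝓤.U r ⊓ 𝓤.U s)) =>
    H.exists_lift _ (Cocycle.val c r s) x.1 x.2
  let 𝓥 : HyperCover X := ⟨𝓤, fun r s => ↥(𝓤.U r ⊓ 𝓤.U s), fun {r s} x => V r s x, fun r s =>
    le_antisymm (iSup_le (hV r s)) fun x hxU => Opens.mem_iSup.2 ⟨⟨x, hxU⟩, hx r s ⟨x, hxU⟩⟩⟩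
  refine ⟨𝓥.E, 𝓥.V, 𝓥.iSup_V, ?_⟩
  let b' : ∀ {r s} (e : 𝓥.E r s), B.sec (𝓥.V e) := fun {r s} e => b r s e
  have hb' : ∀ {r s} (e : 𝓥.E r s),
    GrpSheaf.app p (𝓥.V e) (b' e) = C.res (𝓥.V_le e) (Cocycle.val c r s) := fun {r s} e => hb r s e
  have : ∀ (r s t) (e : 𝓥.E r s) (e' : 𝓥.E s t) (e'' : 𝓥.E r t), ∃ a : A.sec (𝓥.W e e' e''),
      GrpSheaf.app i _ a =
        B.res (HyperCover.W_le₁ e e' e'') (b' e) * B.res (HyperCover.W_le₂ e e' e'') (b' e') *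
          (B.res (HyperCover.W_le₃ e e' e'') (b' e''))⁻¹ := fun r s t e e' e'' => H.exact _ _ (by
    rw [map_mul, map_mul, map_inv, GrpSheaf.app_res, GrpSheaf.app_res, GrpSheaf.app_res, hb', hb',
      hb', GrpSheaf.res_res, GrpSheaf.res_res, GrpSheaf.res_res,
      Cocycle.res_mul_res c r s t _ _ _ ((HyperCover.W_le₃ e e' e'').trans (𝓥.V_le e'')),
      mul_inv_cancel])
  choose a ha using this
  obtain ⟨η, hη⟩ := exists_representsH2 (𝓤 := 𝓥) (F := A.toAb hA)
    (fun e e' e'' => GrpSheaf.toAdd hA (a _ _ _ e e' e''))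
    (fun e e' e'' d d' d'' T h h₀ h₁ h₂ => by
      have key : A.res h (a _ _ _ e e' e'') * A.res h₂ (a _ _ _ e'' d'' d) =
          A.res h₀ (a _ _ _ e d' d) * A.res h₁ (a _ _ _ e' d'' d') := by
        apply H.injective
        have := hc T (A.res h₁ (a _ _ _ e' d'' d'))
          (B.res (h₀.trans (HyperCover.W_le₂ _ _ _)) (b' d') *
            (B.res (h₀.trans (HyperCover.W_le₃ _ _ _)) (b' d))⁻¹)
        simp only [map_mul, GrpSheaf.app_res, ha, map_inv, GrpSheaf.res_res] at this ⊢
        exact mul_inv_mul_mul_inv_of_commute this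
      exact congrArg (GrpSheaf.toAdd hA) key)
  exact ⟨η, b', fun e e' e'' => a _ _ _ e e' e'', hb', fun e e' e'' => ha _ _ _ e e' e'', hη⟩

lemma IsConnectingValue₂.eq_of_equivalent (H : IsExtension i p)
    (hc : ∀ U a b, GrpSheaf.app i U a * b = b * GrpSheaf.app i U a) {𝓤 𝓤' : HyperCover X}
    {c : Cocycle C 𝓤.toOpenCover} {c' : Cocycle C 𝓤'.toOpenCover}
    {η η' : Sheaf.H (A.toAb hA) 2} (h : IsConnectingValue₂ hA i p 𝓤 c η)
    (h' : IsConnectingValue₂ hA i p 𝓤' c' η')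
    (e : Cocycle.Equivalent ⟨𝓤.toOpenCover, c⟩ ⟨𝓤'.toOpenCover, c'⟩) : η = η' := by
  obtain ⟨b, a, h₁, h₂, h₃⟩ := h
  obtain ⟨b', a', h₁', h₂', h₃'⟩ := h'
  obtain ⟨𝓦, ρ, σ, hρ, hσ, g, hg⟩ := e
  choose N hN l hxN hl using fun w : (Σ w : 𝓦.ι, 𝓦.U w) => H.exists_lift _ (g w.1) w.2.1 w.2.2
  let 𝓥 : HyperCover X :=
    { ι := Σ w : 𝓦.ι, 𝓦.U w
      U := N
      isOpenCover := top_le_iff.1 fun x hx => by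
        obtain ⟨w, hw⟩ := Opens.mem_iSup.1 (𝓦.isOpenCover.ge hx)
        exact Opens.mem_iSup.2 ⟨⟨w, x, hw⟩, hxN ⟨w, x, hw⟩⟩
      E := fun v w => 𝓤.E (ρ v.1) (ρ w.1) × 𝓤'.E (σ v.1) (σ w.1)
      V := fun {v w} e => 𝓤.V e.1 ⊓ 𝓤'.V e.2 ⊓ (N v ⊓ N w)
      iSup_V := fun v w => le_antisymm (iSup_le fun _ => inf_le_right) fun x hx => by
        obtain ⟨e, he⟩ := 𝓤.exists_mem (hρ _ (hN v hx.1)) (hρ _ (hN w hx.2))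
        obtain ⟨e', he'⟩ := 𝓤'.exists_mem (hσ _ (hN v hx.1)) (hσ _ (hN w hx.2))
        exact Opens.mem_iSup.2 ⟨(e, e'), ⟨he, he'⟩, hx⟩ }
  let P : 𝓥.Refinement 𝓤 :=
    ⟨fun v => ρ v.1, fun v => (hN v).trans (hρ _), fun e => e.1,
      fun e => inf_le_left.trans inf_le_left⟩
  let P' : 𝓥.Refinement 𝓤' :=
    ⟨fun v => σ v.1, fun v => (hN v).trans (hσ _), fun e => e.2,
      fun e => inf_le_left.trans inf_le_right⟩
  have hVl : ∀ {v w} (e : 𝓥.E v w), 𝓥.V e ≤ N v := fun e => inf_le_right.trans inf_le_left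
  have hVr : ∀ {v w} (e : 𝓥.E v w), 𝓥.V e ≤ N w := fun e => inf_le_right.trans inf_le_right
  have hg' : ∀ {v w} (e : 𝓥.E v w), C.res ((hVl e).trans (hN v)) (g v.1) *
      C.res ((P.V_le e).trans (𝓤.V_le _)) (Cocycle.val c (ρ v.1) (ρ w.1)) =
      C.res ((P'.V_le e).trans (𝓤'.V_le _)) (Cocycle.val c' (σ v.1) (σ w.1)) *
        C.res ((hVr e).trans (hN w)) (g w.1) := fun {v w} e => by
    have := hg v.1 w.1 (homOfLE ((hVl e).trans (hN v))) (homOfLE ((hVr e).trans (hN w)))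
    dsimp only [Cocycle.refine] at this
    rwa [Cocycle.ev_eq, Cocycle.ev_eq] at this
  have : ∀ v w (e : 𝓥.E v w), ∃ α : A.sec (𝓥.V e), GrpSheaf.app i _ α =
      B.res (P'.V_le e) (b' (P'.edge e)) * B.res (hVr e) (l w) *
        (B.res (P.V_le e) (b (P.edge e)))⁻¹ * (B.res (hVl e) (l v))⁻¹ := fun v w e =>
    H.exact _ _ (by
      simp only [map_mul, map_inv, GrpSheaf.app_res, hl, h₁, h₁', GrpSheaf.res_res]
      rw [mul_assoc, ← mul_inv_rev, mul_inv_eq_one]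
      exact (hg' e).symm)
  choose α hα using this
  have key := ((h₃'.refine P').sub (h₃.refine P)).eq_zero
    (fun e => GrpSheaf.toAdd hA (α _ _ e)) (fun {v w z} e e' e'' => by
      have key : A.res (P'.W_le e e' e'') (a' (P'.edge e) (P'.edge e') (P'.edge e'')) *
          A.res (HyperCover.W_le₃ e e' e'') (α _ _ e'') =
          A.res (HyperCover.W_le₁ e e' e'') (α _ _ e) *
          A.res (HyperCover.W_le₂ e e' e'') (α _ _ e') *
          A.res (P.W_le e e' e'') (a (P.edge e) (P.edge e') (P.edge e'')) := by
        apply H.injective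
        have k₁ := hc _ (A.res (HyperCover.W_le₂ e e' e'') (α _ _ e'))
          (B.res ((HyperCover.W_le₁ e e' e'').trans (hVl e)) (l v) *
            B.res ((HyperCover.W_le₁ e e' e'').trans (P.V_le e)) (b (P.edge e)) *
            (B.res ((HyperCover.W_le₁ e e' e'').trans (hVr e)) (l w))⁻¹)
        have k₂ := hc _ (A.res (P.W_le e e' e'') (a (P.edge e) (P.edge e') (P.edge e'')))
          (B.res ((HyperCover.W_le₁ e e' e'').trans (hVl e)) (l v))
        simp only [map_mul, GrpSheaf.app_res, hα, h₂, h₂', map_inv, GrpSheaf.res_res] at k₁ k₂ ⊢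
        exact mul_inv_mul_conj_of_commute k₁ k₂
      have := congrArg (GrpSheaf.toAdd hA) key
      simp only [GrpSheaf.toAdd_mul, GrpSheaf.res_toAdd] at this ⊢
      rw [sub_eq_sub_iff_add_eq_add]
      exact this)
  exact (sub_eq_zero.1 key).symm

lemma IsExtension.exists_isConnecting₂ (hA : A.IsComm) (H : IsExtension i p)
    (hc : ∀ U a b, GrpSheaf.app i U a * b = b * GrpSheaf.app i U a) :
    ∃ δ, IsConnecting₂ hA i p δ := by
  have uniq : ∀ {c c' : Σ 𝓤 : OpenCover X, Cocycle C 𝓤},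
      Relation.EqvGen (Cocycle.Equivalent (G := C)) c c' →
      ∀ (𝓤 𝓤' : HyperCover X) (γ : Cocycle C 𝓤.toOpenCover) (γ' : Cocycle C 𝓤'.toOpenCover) η η',
        ⟨𝓤.toOpenCover, γ⟩ = c → ⟨𝓤'.toOpenCover, γ'⟩ = c' → IsConnectingValue₂ hA i p 𝓤 γ η →
        IsConnectingValue₂ hA i p 𝓤' γ' η' → η = η' := by
    intro c c' h
    induction h with
    | rel c c' h =>
      rintro 𝓤 𝓤' γ γ' η η' rfl rfl h₁ h₂
      exact h₁.eq_of_equivalent H hc h₂ h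
    | refl c =>
      rintro 𝓤 𝓤' γ γ' η η' e e' h₁ h₂
      refine h₁.eq_of_equivalent H hc h₂ ?_
      rw [e, e']
      exact ⟨c.1, id, id, fun _ => le_rfl, fun _ => le_rfl, _,
        PresheafOfGroups.OneCohomologyRelation.refl _⟩
    | symm c c' _ ih =>
      intro 𝓤 𝓤' γ γ' η η' e e' h₁ h₂
      exact (ih 𝓤' 𝓤 γ' γ η' η e' e h₂ h₁).symm
    | trans c c' c'' _ _ ih ih' =>
      intro 𝓤 𝓤' γ γ' η η' e e' h₁ h₂
      obtain ⟨E, V, hV, η'', h₃⟩ := H.exists_isConnectingValue₂ hA hc c'.2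
      exact (ih 𝓤 ⟨c'.1, E, V, hV⟩ γ c'.2 η η'' e rfl h₁ h₃).trans
        (ih' ⟨c'.1, E, V, hV⟩ 𝓤' c'.2 γ' η'' η' rfl e' h₃ h₂)
  have ex : ∀ ξ : CechH1 C, ∃ (𝓤 : HyperCover X) (c : Cocycle C 𝓤.toOpenCover) (η : _),
      ξ = Cocycle.cls c ∧ IsConnectingValue₂ hA i p 𝓤 c η := by
    rintro ⟨𝓤, c⟩
    obtain ⟨E, V, hV, η, h⟩ := H.exists_isConnectingValue₂ hA hc c
    exact ⟨⟨𝓤, E, V, hV⟩, c, η, rfl, h⟩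
  choose 𝓤 c δ hc hδ using ex
  refine ⟨δ, fun ξ η => ⟨?_, ?_⟩⟩
  · rintro rfl
    obtain ⟨b, a, h⟩ := hδ ξ
    exact ⟨_, _, b, a, hc ξ, h⟩
  · rintro ⟨𝓤', c', b, a, e, h⟩
    exact uniq (Quot.eqvGen_exact ((hc ξ).symm.trans e)) _ _ _ _ _ _ rfl rfl (hδ ξ) ⟨b, a, h⟩
end

section
variable {A B B' C C' : GrpSheaf X} {hA : A.IsComm} {i : A ⟶ B} {p : B ⟶ C} {i' : A ⟶ B'}
  {p' : B' ⟶ C'} (g : B ⟶ B') (h : C ⟶ C')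
  (hi : ∀ U a, GrpSheaf.app g U (GrpSheaf.app i U a) = GrpSheaf.app i' U a)
  (hp : ∀ U b, GrpSheaf.app h U (GrpSheaf.app p U b) = GrpSheaf.app p' U (GrpSheaf.app g U b))
include hi hp

lemma IsConnectingValue₁.map {c : C.sec ⊤} {η : Sheaf.H (A.toAb hA) 1}
    (H : IsConnectingValue₁ hA i p c η) :
    IsConnectingValue₁ hA i' p' (GrpSheaf.app h ⊤ c) η := by
  obtain ⟨𝓤, b, γ, h₁, h₂, h₃⟩ := H
  refine ⟨𝓤, fun r => GrpSheaf.app g _ (b r), γ, fun r => ?_, fun r s => ?_, h₃⟩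
  · rw [← hp, h₁, GrpSheaf.app_res]
  · rw [← hi, h₂, map_mul, map_inv, GrpSheaf.app_res, GrpSheaf.app_res]

lemma IsConnectingValue₂.map {𝓤 : HyperCover X} {c : Cocycle C 𝓤.toOpenCover}
    {η : Sheaf.H (A.toAb hA) 2} (H : IsConnectingValue₂ hA i p 𝓤 c η) :
    IsConnectingValue₂ hA i' p' 𝓤 (Cocycle.map h c) η := by
  obtain ⟨b, a, h₁, h₂, h₃⟩ := H
  refine ⟨fun e => GrpSheaf.app g _ (b e), a, fun e => ?_, fun e e' e'' => ?_, h₃⟩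
  · rw [← hp, h₁, GrpSheaf.app_res, Cocycle.map_val]
  · rw [← hi, h₂, map_mul, map_mul, map_inv, GrpSheaf.app_res, GrpSheaf.app_res, GrpSheaf.app_res]
end

lemma isConnectingValue₁_one {A B C : GrpSheaf X} (hA : A.IsComm) (i : A ⟶ B) (p : B ⟶ C) :
    IsConnectingValue₁ hA i p 1 0 := by
  let 𝓤 : OpenCover X := ⟨PUnit, fun _ => ⊤, iSup_const⟩
  let γ : Cocycle A 𝓤 := 1
  obtain ⟨η, hη⟩ := Cocycle.exists_isClassOf hA γ
  have : η = 0 := (RepresentsH1.eq_zero_iff hη).2 ⟨fun _ => 0, fun _ _ => by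
    rw [map_zero, sub_self]; rfl⟩
  subst this
  refine ⟨𝓤, fun _ => 1, γ, fun r => by rw [map_one, map_one], fun r s => ?_, hη⟩
  rw [map_one, inv_one, mul_one]
  exact map_one _

/-- The connecting value of a cocycle with values in `C` which lifts to a cocycle with values in
`B` is trivial. -/
lemma isConnectingValue₂_map {A B C : GrpSheaf X} (hA : A.IsComm) (i : A ⟶ B) (p : B ⟶ C)
    {𝓤 : OpenCover X} (β : Cocycle B 𝓤) :
    IsConnectingValue₂ hA i p ⟨𝓤, fun _ _ => PUnit, fun {r s} _ => 𝓤.U r ⊓ 𝓤.U s,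
      fun _ _ => iSup_const⟩ (Cocycle.map p β) 0 := by
  let 𝓥 : HyperCover X :=
    ⟨𝓤, fun _ _ => PUnit, fun {r s} _ => 𝓤.U r ⊓ 𝓤.U s, fun _ _ => iSup_const⟩
  obtain ⟨η, hη⟩ := exists_representsH2 (𝓤 := 𝓥) (F := A.toAb hA)
    (fun e e' e'' => GrpSheaf.toAdd hA (1 : A.sec (𝓥.W e e' e'')))
    (fun _ _ _ _ _ _ _ _ _ _ _ => by simp only [GrpSheaf.toAdd_one, map_zero])
  have : η = 0 := hη.eq_zero (fun _ => 0) fun _ _ _ => by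
    rw [map_zero, map_zero, map_zero, sub_zero, add_zero]; rfl
  subst this
  refine ⟨fun {r s} _ => Cocycle.val β r s, fun _ _ _ => 1, fun {r s} e => ?_,
    fun {r s t} e e' e'' => ?_, hη⟩
  · rw [Cocycle.map_val]
    exact (GrpSheaf.res_self _ _ _).symm
  · rw [map_one, Cocycle.res_mul_res β r s t _ _ _ (HyperCover.W_le₃ (𝓤 := 𝓥) e e' e''),
      mul_inv_cancel]

lemma mapH0_zero {A B : GrpSheaf X} (hA : A.IsComm) (i : A ⟶ B) : mapH0 hA i 0 = 1 := by
  unfold mapH0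
  rw [map_zero, map_zero]
  exact map_one _

namespace NormalSeries
variable (𝓗 : NormalSeries X)

lemma isExtension {k j : ℕ} (h : k < j) : IsExtension (𝓗.incl h) (𝓗.proj k j) where
  injective _ := 𝓗.quotMap_injective _
  app_app U a := by rw [quotMap_quotMap, 𝓗.quotMap_eq_one le_rfl]
  exact _ b hb := 𝓗.exists_quotMap_eq h.le j.le_succ b hb
  exists_lift U c x hx := by
    obtain ⟨V, h, b, hxV, hb⟩ := 𝓗.exists_local_quotMap_eq j.le_succ c x hx
    exact ⟨V, h, b, hxV, hb⟩

/-- A global section of `𝓗_j / 𝓗_{j+1}` has a connecting value in `𝓗_{j+1} / 𝓗_{j+2}` which is the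
class of a cocycle that lifts to a cocycle with values in `𝓗_{j+1} / 𝓗_{j+3}`. -/
lemma exists_cocycle_lift {j : ℕ} (hA : (𝓗.quot (j + 1) (j + 2)).IsComm)
    (c : (𝓗.quot j (j + 1)).sec ⊤) :
    ∃ (𝓤 : OpenCover X) (β : Cocycle (𝓗.quot (j + 1) (j + 3)) 𝓤) (η : _),
      IsConnectingValue₁ hA (𝓗.incl (Nat.lt_succ_self j)) (𝓗.proj j (j + 1)) c η ∧
      IsClassOf hA (Cocycle.map (𝓗.proj (j + 1) (j + 2)) β) η := by
  choose V hV b hx hb using fun x : X =>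
    𝓗.exists_local_quotMap_eq (j := j + 3) (show j + 1 ≤ j + 3 by lia) c x (Opens.mem_top x)
  let 𝓤 : OpenCover X := ⟨X, V, top_le_iff.1 fun x _ => Opens.mem_iSup.2 ⟨x, hx x⟩⟩
  have : ∀ r s, ∃ β : (𝓗.quot (j + 1) (j + 3)).sec (V r ⊓ V s),
      GrpSheaf.app (𝓗.quotMap j.le_succ (le_refl (j + 3))) _ β =
        (𝓗.quot j (j + 3)).res inf_le_left (b r) *
          ((𝓗.quot j (j + 3)).res inf_le_right (b s))⁻¹ := fun r s =>
    𝓗.exists_quotMap_eq j.le_succ (by lia) _ (by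
      rw [map_mul, map_inv, GrpSheaf.app_res, GrpSheaf.app_res, hb, hb, GrpSheaf.res_res,
        GrpSheaf.res_res, mul_inv_cancel])
  choose β hβ using this
  have hβ' : ∀ r s t (T : Opens X) (hrs : T ≤ V r ⊓ V s) (hst : T ≤ V s ⊓ V t)
      (hrt : T ≤ V r ⊓ V t), (𝓗.quot (j + 1) (j + 3)).res hrs (β r s) *
        (𝓗.quot (j + 1) (j + 3)).res hst (β s t) = (𝓗.quot (j + 1) (j + 3)).res hrt (β r t) :=
    fun r s t T hrs hst hrt => 𝓗.quotMap_injective j.le_succ (by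
      simp only [map_mul, GrpSheaf.app_res, hβ, map_inv, GrpSheaf.res_res]
      group)
  let β' : Cocycle (𝓗.quot (j + 1) (j + 3)) 𝓤 := Cocycle.ofVal β hβ'
  obtain ⟨η, hη⟩ := Cocycle.exists_isClassOf hA (Cocycle.map (𝓗.proj (j + 1) (j + 2)) β')
  refine ⟨𝓤, β', η, ⟨𝓤, fun r => GrpSheaf.app (𝓗.quotMap (le_refl j) (Nat.le_succ (j + 2))) _ (b r),
    _, fun r => ?_, fun r s => ?_, hη⟩, hη⟩
  · rw [quotMap_quotMap]
    exact hb r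
  · rw [Cocycle.map_val, quotMap_quotMap, Cocycle.ofVal_val, ← GrpSheaf.app_res,
      ← GrpSheaf.app_res, ← map_inv, ← map_mul, ← hβ, quotMap_quotMap]
end NormalSeries
end AQSeries

theorem mainTheorem12 {X : TopCat.{u}} (𝓗 : AQSeries.AQCentralSeries X) (j : ℕ) :
    ∃ (d₁ : Sheaf.H (𝓗.A j) 0 → Sheaf.H (𝓗.A (j + 1)) 1)
      (d₂ : Sheaf.H (𝓗.A (j + 1)) 1 → Sheaf.H (𝓗.A (j + 2)) 2),
      (∀ (k : ℕ) (hk : k < j + 1), 𝓗.IsCentralAt hk →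
        ∃ δ : (𝓗.quot k (j + 1)).sec ⊤ → Sheaf.H (𝓗.A (j + 1)) 1,
          AQSeries.IsConnecting₁ (𝓗.comm (j + 1)) (𝓗.incl hk) (𝓗.proj k (j + 1)) δ ∧
          ∀ θ, d₁ θ = δ (AQSeries.mapH0 (𝓗.comm j) (𝓗.quotMap (Nat.lt_succ_iff.mp hk) le_rfl) θ)) ∧
      (∀ (k : ℕ) (hk : k < j + 2), 𝓗.IsCentralAt hk →
        ∃ (φ : Sheaf.H (𝓗.A (j + 1)) 1 → AQSeries.CechH1 (𝓗.quot k (j + 2)))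
          (δ : AQSeries.CechH1 (𝓗.quot k (j + 2)) → Sheaf.H (𝓗.A (j + 2)) 2),
          AQSeries.IsMapH1 (𝓗.comm (j + 1)) (𝓗.quotMap (Nat.lt_succ_iff.mp hk) le_rfl) φ ∧
          AQSeries.IsConnecting₂ (𝓗.comm (j + 2)) (𝓗.incl hk) (𝓗.proj k (j + 2)) δ ∧
          ∀ η, d₂ η = δ (φ η)) ∧
      d₁ 0 = 0 ∧ d₂ 0 = 0 ∧ ∀ θ, d₂ (d₁ θ) = 0 := by
  have E₁ := 𝓗.isExtension (Nat.lt_succ_self j)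
  have E₂ := 𝓗.isExtension (Nat.lt_succ_self (j + 1))
  have cen : 𝓗.IsCentralAt (Nat.lt_succ_self (j + 1)) := by
    obtain ⟨k, hk, h⟩ := 𝓗.central (j + 2) (by lia)
    exact h.mono _ hk (Nat.lt_succ_iff.mp hk) _
  obtain ⟨δ₁, hδ₁⟩ := E₁.exists_isConnecting₁ (𝓗.comm (j + 1))
  obtain ⟨δ₂, hδ₂⟩ := E₂.exists_isConnecting₂ (𝓗.comm (j + 2)) cen
  obtain ⟨φ, hφ⟩ := AQSeries.exists_isMapH1 (𝓗.comm (j + 1))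
    (𝓗.quotMap (le_refl (j + 1)) (le_refl (j + 2)))
  have hd₁ : ∀ c η, AQSeries.IsConnectingValue₁ (𝓗.comm (j + 1)) (𝓗.incl (Nat.lt_succ_self j))
      (𝓗.proj j (j + 1)) c η → δ₁ c = η := fun c η h => (hδ₁ c η).2 h
  have hd₂ : ∀ (𝓤 : AQSeries.HyperCover X)
      (γ : AQSeries.Cocycle (𝓗.quot (j + 1) (j + 2)) 𝓤.toOpenCover) η κ,
      AQSeries.IsClassOf (𝓗.comm (j + 1)) γ η → AQSeries.IsConnectingValue₂ (𝓗.comm (j + 2))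
        (𝓗.incl (Nat.lt_succ_self (j + 1))) (𝓗.proj (j + 1) (j + 2)) 𝓤 γ κ → δ₂ (φ η) = κ := by
    intro 𝓤 γ η κ h h'
    obtain ⟨b, a, h'⟩ := h'
    have e : AQSeries.Cocycle.map (𝓗.quotMap (le_refl (j + 1)) (le_refl (j + 2))) γ = γ :=
      AQSeries.Cocycle.ext_ev fun r s T f g => 𝓗.quotMap_self _
    exact (hδ₂ _ _).2 ⟨𝓤, γ, b, a, ((hφ η _).2 ⟨_, γ, h, rfl⟩).trans (congrArg _ e), h'⟩
  have zero₁ : δ₁ (AQSeries.mapH0 (𝓗.comm j) (𝓗.quotMap (le_refl j) (le_refl (j + 1))) 0) = 0 := by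
    rw [AQSeries.mapH0_zero]
    exact hd₁ _ _ (AQSeries.isConnectingValue₁_one _ _ _)
  have comp : ∀ c, δ₂ (φ (δ₁ c)) = 0 := fun c => by
    obtain ⟨𝓤, β, η, h, h'⟩ := 𝓗.exists_cocycle_lift (𝓗.comm (j + 1)) c
    rw [hd₁ c η h]
    exact hd₂ ⟨𝓤, fun _ _ => PUnit, fun {r s} _ => 𝓤.U r ⊓ 𝓤.U s, fun _ _ => iSup_const⟩ _ _ _ h'
      (AQSeries.isConnectingValue₂_map _ _ _ β)
  refine ⟨fun θ => δ₁ (AQSeries.mapH0 (𝓗.comm j) (𝓗.quotMap le_rfl le_rfl) θ), fun η => δ₂ (φ η),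
    fun k hk _ => ?_, fun k hk hc => ?_, zero₁, ?_, fun θ => comp _⟩
  · obtain ⟨δ, hδ⟩ := (𝓗.isExtension hk).exists_isConnecting₁ (𝓗.comm (j + 1))
    refine ⟨δ, hδ, fun θ => Eq.symm ((hδ _ _).2 ?_)⟩
    have := AQSeries.IsConnectingValue₁.map (i' := 𝓗.incl hk) (p' := 𝓗.proj k (j + 1))
      (𝓗.quotMap (Nat.lt_succ_iff.mp hk) le_rfl) (𝓗.quotMap (Nat.lt_succ_iff.mp hk) le_rfl)
      (fun U a => by rw [AQSeries.NormalSeries.quotMap_quotMap])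
      (fun U b => by
        rw [AQSeries.NormalSeries.quotMap_quotMap, AQSeries.NormalSeries.quotMap_quotMap])
      ((hδ₁ (AQSeries.mapH0 (𝓗.comm j) (𝓗.quotMap le_rfl le_rfl) θ) _).1 rfl)
    unfold AQSeries.mapH0 at this
    rw [AQSeries.NormalSeries.quotMap_quotMap] at this
    exact this
  · obtain ⟨φ', hφ'⟩ := AQSeries.exists_isMapH1 (𝓗.comm (j + 1))
      (𝓗.quotMap (Nat.lt_succ_iff.mp hk) (le_refl (j + 2)))
    obtain ⟨δ, hδ⟩ := (𝓗.isExtension hk).exists_isConnecting₂ (𝓗.comm (j + 2)) hc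
    refine ⟨φ', δ, hφ', hδ, fun η => ?_⟩
    obtain ⟨𝓤, γ, hγ⟩ := AQSeries.exists_isClassOf η
    obtain ⟨E, V, hV, κ, hκ⟩ := E₂.exists_isConnectingValue₂ (𝓗.comm (j + 2)) cen γ
    refine (hd₂ ⟨𝓤, E, V, hV⟩ γ η κ hγ hκ).trans ?_
    rw [(hφ' η _).2 ⟨_, γ, hγ, rfl⟩]
    obtain ⟨b, a, h⟩ := AQSeries.IsConnectingValue₂.map (i' := 𝓗.incl hk) (p' := 𝓗.proj k (j + 2))
      (𝓗.quotMap (Nat.lt_succ_iff.mp hk) le_rfl) (𝓗.quotMap (Nat.lt_succ_iff.mp hk) le_rfl)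
      (fun U a => by rw [AQSeries.NormalSeries.quotMap_quotMap])
      (fun U b => by
        rw [AQSeries.NormalSeries.quotMap_quotMap, AQSeries.NormalSeries.quotMap_quotMap]) hκ
    exact ((hδ _ _).2 ⟨⟨𝓤, E, V, hV⟩, _, b, a, rfl, h⟩).symm
  · have := comp (AQSeries.mapH0 (𝓗.comm j) (𝓗.quotMap (le_refl j) (le_refl (j + 1))) 0)
    rwa [zero₁] at this
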